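/- Let $(X,d)$ be a Gromov hyperbolic space, i.e. a geodesic metric space such that, for some $\delta\ge 0$, all geodesic triangles are $\delta$-thin ($X$ need not be proper), and let $\partial X$ be its Gromov boundary, the set of quasigeodesic rays modulo finite Hausdorff distance. Let $G$ be a group acting on $X$ by isometries. An element $g\in G$ is \emph{loxodromic} if its translation length $\tau(g)=\lim_{n\to\infty} d(g^n x,x)/n$ is positive (the limit exists and does not depend on $x\in X$); two loxodromic elements are \emph{independent} if they have no common fixed point on $\partial X$. A loxodromic element $h\in G$ is \emph{WPD} (in $G$) if for every $K\ge 0$ and every $x\in X$ there is an integer $M>0$ such that the set $$\{g\in G : d(x,gx)\le K \text{ and } d(h^M x, g h^M x)\le K\}$$ is finite. Let $\mu$ be a probability measure on $G$, and let $\Gamma_\mu$ be the semigroup generated by the support of $\mu$. Suppose that - $\mu$ is countable: its support is countable; - $\mu$ is non-elementary: $\Gamma_\mu$ contains two independent loxodromic elements; - $\mu$ is bounded: for some $x\in X$ the set $\{gx : g\in\operatorname{supp}\mu\}$ is bounded in $X$; - $\Gamma_\mu$ contains an element that is WPD in $G$. Let $g_1,g_2,\dots$ be independent random elements of $G$ with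 distribution $\mu$, and let $w_n=g_1g_2\cdots g_n$. Then there are constants $B>0$ and $0<c<1$ such that for every $n\ge 0$ $$\mathbb{P}(w_n \text{ is WPD})\ \ge\ 1-Bc^{\sqrt n}.$$ -/

import Mathlib

open MeasureTheory Filter
open scoped Topology NNReal ENNReal

noncomputable section

namespace WPD

section Hyperbolic

variable {X : Type*} [MetricSpace X]

/-- `s` is (the image of) a geodesic segment joining `x` to `y`. -/
def IsGeodesicSegment (x y : X) (s : Set X) : Prop :=
  ∃ γ : ℝ → X, γ 0 = x ∧ γ (dist x y) = y ∧
    (∀ a ∈ Set.Icc 0 (dist x y), ∀ b ∈ Set.Icc 0 (dist x y), dist (γ a) (γ b) = |a - b|) ∧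
    s = γ '' Set.Icc 0 (dist x y)

variable (X) in
/-- Gromov hyperbolic space: a geodesic metric space all of whose geodesic triangles are
`δ`-thin, for some `δ ≥ 0`. -/
structure IsGromovHyperbolic : Prop where
  geodesic : ∀ x y : X, ∃ s, IsGeodesicSegment x y s
  thin : ∃ δ : ℝ, 0 ≤ δ ∧ ∀ (x y z : X) (a b c : Set X),
    IsGeodesicSegment x y a → IsGeodesicSegment y z b → IsGeodesicSegment x z c →
    ∀ p ∈ a, ∃ q ∈ b ∪ c, dist p q ≤ δ

variable (X) in
/-- Quasigeodesic rays in `X`. -/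
def QuasigeodesicRay : Type _ :=
  {γ : ℝ≥0 → X // ∃ K C : ℝ, 1 ≤ K ∧ 0 ≤ C ∧ ∀ s t : ℝ≥0,
    dist s t / K - C ≤ dist (γ s) (γ t) ∧ dist (γ s) (γ t) ≤ K * dist s t + C}

variable (X) in
/-- Two quasigeodesic rays are asymptotic if their images are at finite Hausdorff distance. -/
def asymptoticSetoid : Setoid (QuasigeodesicRay X) where
  r γ η := Metric.hausdorffEDist (Set.range γ.1) (Set.range η.1) ≠ ⊤
  iseqv :=
    { refl := fun γ => by simp
      symm := fun {γ η} h => by rwa [Metric.hausdorffEDist_comm]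
      trans := fun {γ η ζ} h₁ h₂ =>
        ne_top_of_le_ne_top (ENNReal.add_ne_top.2 ⟨h₁, h₂⟩) Metric.hausdorffEDist_triangle }

variable (X) in
/-- The Gromov boundary: asymptote classes of quasigeodesic rays. -/
def GromovBoundary : Type _ := Quotient (asymptoticSetoid X)

end Hyperbolic

section Action

variable {G : Type*} [Group G] {X : Type*} [MetricSpace X] [MulAction G X] [IsIsometricSMul G X]

/-- The translate of a quasigeodesic ray by an isometry. -/
def QuasigeodesicRay.translate (g : G) (γ : QuasigeodesicRay X) : QuasigeodesicRay X :=
  ⟨fun t => g • γ.1 t, by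
    obtain ⟨K, C, hK, hC, h⟩ := γ.2
    exact ⟨K, C, hK, hC, fun s t => by simpa only [dist_smul] using h s t⟩⟩

/-- The action of an isometry on the Gromov boundary. -/
def boundaryMap (g : G) : GromovBoundary X → GromovBoundary X :=
  Quotient.map' (s₁ := asymptoticSetoid X) (s₂ := asymptoticSetoid X)
    (QuasigeodesicRay.translate g) (fun γ η h => by
      have e : ∀ ζ : QuasigeodesicRay X, Set.range (QuasigeodesicRay.translate g ζ).1 =
          (fun x : X => g • x) '' Set.range ζ.1 := fun ζ =>
        Set.range_comp (fun x : X => g • x) ζ.1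
      change Metric.hausdorffEDist _ _ ≠ ⊤
      rw [e, e, Metric.hausdorffEDist_image (isometry_smul X g)]
      exact h)

variable (X) in
/-- The fixed point set of `g` on the Gromov boundary. -/
def boundaryFix (g : G) : Set (GromovBoundary X) := {ξ | boundaryMap g ξ = ξ}

variable (X) in
/-- `g` is loxodromic if it has positive translation length
`τ = lim d(gⁿ x, x) / n` (a limit that does not depend on `x`). -/
def IsLoxodromic (g : G) : Prop :=
  ∃ τ : ℝ, 0 < τ ∧ ∀ x : X, Tendsto (fun n : ℕ => dist (g ^ n • x) x / n) atTop (𝓝 τ)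

variable (X) in
/-- Independent loxodromic elements: no common fixed point on the Gromov boundary. -/
def AreIndependentLoxodromic (g h : G) : Prop :=
  IsLoxodromic X g ∧ IsLoxodromic X h ∧ Disjoint (boundaryFix X g) (boundaryFix X h)

variable (G) in
/-- Joint coarse stabilizer of two points. -/
def jointCoarseStab (K : ℝ) (x y : X) : Set G :=
  {g | dist x (g • x) ≤ K ∧ dist y (g • y) ≤ K}

variable (X) in
/-- `h` is a WPD element of `G`, for the action of `G` on `X`. -/
def IsWPD (h : G) : Prop :=
  IsLoxodromic X h ∧ ∀ K : ℝ, 0 ≤ K → ∀ x : X, ∃ M : ℕ, 0 < M ∧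
    (jointCoarseStab G K x (h ^ M • x)).Finite

end Action

section Walk

variable {G : Type*} [Group G] [MeasurableSpace G]

/-- The support of a discrete measure: the set of its atoms. -/
def atoms (μ : Measure G) : Set G := {g | μ {g} ≠ 0}

/-- `μ` is countable: it is carried by a countable set. -/
def IsCountableMeasure (μ : Measure G) : Prop := ∃ S : Set G, S.Countable ∧ μ Sᶜ = 0

/-- The semigroup `Γ_μ` generated by the support of `μ`. -/
def supportSemigroup (μ : Measure G) : Subsemigroup G := Subsemigroup.closure (atoms μ)

section

variable (X : Type*) [MetricSpace X] [MulAction G X] [IsIsometricSMul G X]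

def IsNonElementary (μ : Measure G) : Prop :=
  ∃ g ∈ supportSemigroup μ, ∃ h ∈ supportSemigroup μ, AreIndependentLoxodromic X g h

def IsBoundedMeasure (μ : Measure G) : Prop :=
  ∃ x : X, Bornology.IsBounded ((fun g : G => g • x) '' atoms μ)

/-- `Γ_μ` contains an element that is WPD in `G`. -/
def IsWPDMeasure (μ : Measure G) : Prop := ∃ h ∈ supportSemigroup μ, IsWPD X h

end

/-- The law of a sequence of independent steps with distribution `μ`. -/
def stepLaw (μ : Measure G) [IsProbabilityMeasure μ] : Measure (ℕ → G) :=
  Measure.infinitePi (fun _ : ℕ => μ)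

/-- The position `w_n = g₁ g₂ ⋯ g_n` of the random walk, where `g_{i+1} = ω i`. -/
def walk (ω : ℕ → G) : ℕ → G
  | 0 => 1
  | n + 1 => walk ω n * ω n

end Walk

end WPD

end

/-! Write $m=\lfloor\sqrt n\rfloor$ and cut the walk into about $m$ blocks of length $m$. Let $H$ be
a long power of the given WPD element and $s_1,\dots,s_{12}$ a Schottky family built from the two
independent loxodromics. Whatever precedes and follows, some product $s_iHs_j$ fits between them
without backtracking, and a fixed number $k$ of steps realizes it with probability bounded below.
So, up to probability $\theta^{m-2}$, some block starts with such an insertion $g$, aligned with the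
product $u$ of everything before it and with the product $v$ of the rest of its block. If $z$ is the
product of the remaining steps, then $w_n=ugvz$.

This factorization makes $w_n$ WPD as soon as $u,v,z$ are long and the junctions $v|z$ and
(cyclically) $z|u$ backtrack little. The periodic word then spans a local quasigeodesic, hence a
global one (`IsChain.gp_le_of_lt`, `IsChain.le_dist_add`), so $w_n$ is loxodromic and translates of
the segment from $o$ to $Ho$ lie along its axis. Elements that nearly fix two distant points of the
axis are, up to finitely many classes, elements that nearly fix the ends of such a segment, by a
constant depending only on $C$ and $\delta$; there are finitely many of these
(`jointCoarseStab_finite_of_far`, `isWPD_of_aligned`).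

The remaining conditions hold up to an error exponentially small in $m$. Inserting a random Schottky
element moves any point away from $o$ on average (`IsSchottky.sum_dist_ge`), which gives a positive
drift away from every point (`exists_drift`), hence exponential decay of
$\mathbb{E}\,e^{-\varepsilon d(y,w_no)}$, uniformly in the point $y$ (`exists_hasExpDecay`). This
bounds the probability that a piece is short, and also that it follows a prescribed direction for
long, since its path would have to come near a point on the way (`HasExpDecay.stepProb_gp_le`).
Blocks of length $\sqrt n$ balance $\theta^{m-2}$ against these errors. No boundary measure or
properness is used. -/

noncomputable section

namespace WPD

/-! ### Gromov products and the four-point condition. -/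

section GromovProduct

variable {X : Type*} [MetricSpace X]

/-- The Gromov product of `x` and `y` based at `w`. -/
def gp (w x y : X) : ℝ := (dist w x + dist w y - dist x y) / 2

lemma gp_comm (w x y : X) : gp w x y = gp w y x := by
  simp only [gp, dist_comm x y]; ring

lemma gp_nonneg (w x y : X) : 0 ≤ gp w x y := by
  have := dist_triangle_left x y w
  simp only [gp]; linarith

lemma gp_le_dist_left (w x y : X) : gp w x y ≤ dist w x := by
  have := dist_triangle w x y
  simp only [gp]; linarith

lemma gp_le_dist_right (w x y : X) : gp w x y ≤ dist w y := by
  rw [gp_comm]; exact gp_le_dist_left w y x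

lemma gp_add_gp (w x y : X) : gp w x y + gp x w y = dist w x := by
  simp only [gp, dist_comm x w]; ring

lemma dist_eq_gp (w x y : X) : dist x y = dist w x + dist w y - 2 * gp w x y := by
  simp only [gp]; ring

lemma gp_le_add_base (w w' x y : X) : gp w x y ≤ gp w' x y + dist w w' := by
  have h₁ := dist_triangle w w' x
  have h₂ := dist_triangle w w' y
  simp only [gp]; linarith

lemma gp_le_add_left (w x x' y : X) : gp w x y ≤ gp w x' y + dist x x' := by
  have h₁ := dist_triangle w x' x
  have h₂ := dist_triangle x' x y
  rw [dist_comm x' x] at h₁ h₂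
  simp only [gp]; linarith

lemma gp_le_add_right (w x y y' : X) : gp w x y ≤ gp w x y' + dist y y' := by
  rw [gp_comm w x y, gp_comm w x y']; exact gp_le_add_left w y y' x

lemma gp_smul {G : Type*} [Group G] [MulAction G X] [IsIsometricSMul G X] (g : G) (w x y : X) :
    gp (g • w) (g • x) (g • y) = gp w x y := by
  simp only [gp, dist_smul]

variable (X) in
/-- The four-point form of hyperbolicity. -/
def FourPoint (δ : ℝ) : Prop :=
  ∀ w x y z : X, min (gp w x y) (gp w y z) ≤ gp w x z + δ

lemma FourPoint.nonneg {δ : ℝ} (h : FourPoint X δ) (x : X) : 0 ≤ δ := by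
  have := h x x x x
  simp only [gp, dist_self] at this
  norm_num at this
  exact this

lemma FourPoint.min_le {δ : ℝ} (h : FourPoint X δ) (w x y z u : X) :
    min (gp w x y) (min (gp w y z) (gp w z u)) ≤ gp w x u + 2 * δ := by
  have h₁ := h w x z u
  have h₂ := h w x y z
  simp only [min_le_iff] at *
  rcases h₁ with h₁ | h₁
  · rcases h₂ with h₂ | h₂
    · left; linarith
    · right; left; linarith
  · have := h.nonneg w
    right; right; linarith

variable (X) in
/-- Every pair of points can be interpolated at any prescribed distance. -/
def HasGeodesicPoints : Prop :=
  ∀ (x y : X) (r : ℝ), 0 ≤ r → r ≤ dist x y →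
    ∃ p, dist x p = r ∧ dist p y = dist x y - r

lemma IsGeodesicSegment.dist_add_dist {x y p : X} {s : Set X} (hs : IsGeodesicSegment x y s)
    (hp : p ∈ s) : dist x p + dist p y = dist x y := by
  obtain ⟨γ, h0, h1, hγ, rfl⟩ := hs
  obtain ⟨t, ht, rfl⟩ := hp
  have e₁ := hγ 0 (by simp) t ht
  have e₂ := hγ t ht (dist x y) (by simp)
  rw [h0, zero_sub, abs_neg, abs_of_nonneg ht.1] at e₁
  rw [h1, abs_sub_comm, abs_of_nonneg (sub_nonneg.2 ht.2)] at e₂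
  rw [e₁, e₂]; ring

lemma IsGeodesicSegment.left_mem {x y : X} {s : Set X} (hs : IsGeodesicSegment x y s) :
    x ∈ s := by
  obtain ⟨γ, h0, -, -, rfl⟩ := hs
  exact ⟨0, by simp, h0⟩

lemma IsGeodesicSegment.right_mem {x y : X} {s : Set X} (hs : IsGeodesicSegment x y s) :
    y ∈ s := by
  obtain ⟨γ, -, h1, -, rfl⟩ := hs
  exact ⟨dist x y, by simp, h1⟩

lemma IsGeodesicSegment.isPreconnected {x y : X} {s : Set X} (hs : IsGeodesicSegment x y s) :
    IsPreconnected s := by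
  obtain ⟨γ, -, -, hγ, rfl⟩ := hs
  refine isPreconnected_Icc.image γ ?_
  have : LipschitzOnWith 1 γ (Set.Icc 0 (dist x y)) := by
    refine LipschitzOnWith.of_dist_le_mul fun a ha b hb => ?_
    rw [hγ a ha b hb, NNReal.coe_one, one_mul, Real.dist_eq]
  exact this.continuousOn

lemma IsGeodesicSegment.gp_le_dist {x y p w : X} {s : Set X} (hs : IsGeodesicSegment x y s)
    (hp : p ∈ s) : gp w x y ≤ dist w p := by
  have h := hs.dist_add_dist hp
  have h₁ := dist_triangle w p x
  have h₂ := dist_triangle w p y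
  rw [dist_comm p x] at h₁
  simp only [gp]; linarith

lemma IsGromovHyperbolic.hasGeodesicPoints (hX : IsGromovHyperbolic X) : HasGeodesicPoints X := by
  intro x y r h0 h1
  obtain ⟨s, hs⟩ := hX.geodesic x y
  have hs' := hs
  obtain ⟨γ, e0, -, hγ, rfl⟩ := hs
  have hr : γ r ∈ γ '' Set.Icc 0 (dist x y) := ⟨r, ⟨h0, h1⟩, rfl⟩
  have e := hγ 0 (by simp) r ⟨h0, h1⟩
  rw [e0, zero_sub, abs_neg, abs_of_nonneg h0] at e
  refine ⟨γ r, e, ?_⟩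
  have := hs'.dist_add_dist hr
  linarith

/-- A geodesic from $y$ to $z$ is connected and covered by open neighbourhoods of the two other
sides of the triangle with apex $w$, so one of its points is near both sides. Such a point realizes
the Gromov product at $w$ as a distance, up to a constant; thinness of the triangle $x,y,z$ then
gives the four-point inequality. -/
lemma IsGromovHyperbolic.exists_fourPoint (hX : IsGromovHyperbolic X) : ∃ δ, FourPoint X δ := by
  obtain ⟨δ, hδ, thin⟩ := hX.thin
  have key : ∀ (w y z : X) (s : Set X), IsGeodesicSegment y z s →
      ∃ p ∈ s, dist w p ≤ gp w y z + 2 * (δ + 1) := by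
    intro w y z s hs
    obtain ⟨a, ha⟩ := hX.geodesic z w
    obtain ⟨b, hb⟩ := hX.geodesic y w
    have hcov : s ⊆ Metric.thickening (δ + 1) a ∪ Metric.thickening (δ + 1) b := by
      intro p hp
      obtain ⟨q, hq | hq, hd⟩ := thin y z w s a b hs ha hb p hp
      · exact Or.inl (Metric.mem_thickening_iff.2 ⟨q, hq, by linarith⟩)
      · exact Or.inr (Metric.mem_thickening_iff.2 ⟨q, hq, by linarith⟩)
    obtain ⟨p, hp, hpa, hpb⟩ := hs.isPreconnected _ _ Metric.isOpen_thickening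
      Metric.isOpen_thickening hcov
      ⟨z, hs.right_mem, Metric.mem_thickening_iff.2 ⟨z, ha.left_mem, by simp; linarith⟩⟩
      ⟨y, hs.left_mem, Metric.mem_thickening_iff.2 ⟨y, hb.left_mem, by simp; linarith⟩⟩
    refine ⟨p, hp, ?_⟩
    obtain ⟨q₁, hq₁, d₁⟩ := Metric.mem_thickening_iff.1 hpa
    obtain ⟨q₂, hq₂, d₂⟩ := Metric.mem_thickening_iff.1 hpb
    have e₁ := ha.dist_add_dist hq₁
    have e₂ := hb.dist_add_dist hq₂
    have e := hs.dist_add_dist hp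
    have t₁ := dist_triangle w q₁ p
    have t₂ := dist_triangle w q₂ p
    have t₃ := dist_triangle p q₁ z
    have t₄ := dist_triangle p q₂ y
    simp only [gp, dist_comm] at *
    linarith
  refine ⟨3 * (δ + 1), fun w x y z => ?_⟩
  obtain ⟨s, hs⟩ := hX.geodesic x z
  obtain ⟨b, hb⟩ := hX.geodesic z y
  obtain ⟨c, hc⟩ := hX.geodesic x y
  obtain ⟨p, hp, hd⟩ := key w x z s hs
  obtain ⟨q, hq | hq, hpq⟩ := thin x z y s b c hs hb hc p hp
  · have h₁ := hb.gp_le_dist (w := w) hq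
    have h₂ := dist_triangle w p q
    rw [gp_comm w z y] at h₁
    exact (min_le_right _ _).trans (by linarith)
  · have h₁ := hc.gp_le_dist (w := w) hq
    have h₂ := dist_triangle w p q
    exact (min_le_left _ _).trans (by linarith)

end GromovProduct

/-! ### Local-to-global principle for sequences with small Gromov products. -/

section Chains

variable {X : Type*} [MetricSpace X]

/-- A sequence of points whose consecutive Gromov products are controlled by `c`, and whose steps
are long compared to `c`. -/
structure IsChain (δ : ℝ) (x : ℕ → X) (c : ℕ → ℝ) : Prop where
  nonneg : ∀ i, 0 ≤ c i
  gp_le : ∀ i, gp (x (i + 1)) (x i) (x (i + 2)) ≤ c (i + 1)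
  le_dist : ∀ i, c i + c (i + 1) + 3 * δ + 1 ≤ dist (x i) (x (i + 1))

variable {δ : ℝ} {x : ℕ → X} {c : ℕ → ℝ}

/-- The error $\delta$ does not accumulate: the inductive hypothesis only serves to show that, seen
from the new point, the initial and the previous point are in the same direction, beyond what the
local bound on backtracking could allow. One use of the four-point condition then carries the local
bound over. -/
lemma IsChain.gp_succ_le (hδ : FourPoint X δ) (h : IsChain δ x c) (i k : ℕ) :
    gp (x (i + k + 1)) (x i) (x (i + k + 2)) ≤ c (i + k + 1) + δ := by
  have h0 := hδ.nonneg (x 0)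
  induction k with
  | zero => have := h.gp_le i; simp only [add_zero]; linarith
  | succ k ih =>
    have h₁ := h.gp_le (i + k + 1)
    have h₂ := h.le_dist (i + k + 1)
    have h₃ := hδ (x (i + k + 1 + 1)) (x (i + k + 1)) (x i) (x (i + k + 1 + 2))
    have h₄ := gp_add_gp (x (i + k + 1)) (x (i + k + 2)) (x i)
    rw [gp_comm] at ih
    rw [gp_comm (x (i + k + 2))] at h₄
    rw [gp_comm (x (i + k + 1 + 1)) (x (i + k + 1)) (x i)] at h₃
    simp only [← add_assoc, min_le_iff] at *
    rcases h₃ with h₃ | h₃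
    · rw [gp_comm] at h₃
      simp only [show i + k + 1 + 1 = i + k + 2 from rfl] at *
      rw [gp_comm (x (i + k + 2)) (x i) (x (i + k + 1))] at h₄
      linarith
    · simp only [show i + k + 1 + 1 = i + k + 2 from rfl] at *
      linarith

lemma IsChain.gp_pred_le (hδ : FourPoint X δ) (h : IsChain δ x c) (k i : ℕ) :
    gp (x (i + 1)) (x i) (x (i + k + 2)) ≤ c (i + 1) + δ := by
  have h0 := hδ.nonneg (x 0)
  induction k generalizing i with
  | zero => have := h.gp_le i; simp only [add_zero]; linarith
  | succ k ih =>
    have ih := ih (i + 1)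
    have h₁ := h.gp_le i
    have h₂ := h.le_dist (i + 1)
    rw [show i + 1 + k + 2 = i + (k + 1) + 2 by ring, show i + 1 + 1 = i + 2 by ring] at ih
    rw [show i + 1 + 1 = i + 2 by ring] at h₂
    have h₃ := hδ (x (i + 1)) (x i) (x (i + (k + 1) + 2)) (x (i + 2))
    have h₄ := gp_add_gp (x (i + 1)) (x (i + 2)) (x (i + (k + 1) + 2))
    rw [gp_comm (x (i + 1)) (x (i + (k + 1) + 2)) (x (i + 2))] at h₃
    simp only [min_le_iff] at h₃
    rcases h₃ with h₃ | h₃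
    · linarith
    · linarith

/-- The two one-sided bounds are glued by a further use of the four-point condition, whence the
second $\delta$. The bound at $x_j$ involves $c_j$ alone, so large constants elsewhere in the chain
do no harm. -/
lemma IsChain.gp_le_of_lt (hδ : FourPoint X δ) (h : IsChain δ x c) {i j k : ℕ} (hij : i < j)
    (hjk : j < k) : gp (x j) (x i) (x k) ≤ c j + 2 * δ := by
  have h0 := hδ.nonneg (x 0)
  obtain ⟨a, rfl⟩ := Nat.exists_eq_add_of_lt hij
  obtain ⟨b, rfl⟩ := Nat.exists_eq_add_of_lt hjk
  have h₁ := h.gp_succ_le hδ i a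
  rcases Nat.eq_zero_or_pos b with rfl | hb
  · simp only [add_zero]; linarith!
  obtain ⟨b, rfl⟩ : ∃ b', b = b' + 1 := ⟨b - 1, by omega⟩
  have h₂ := h.gp_pred_le hδ b (i + a + 1)
  have h₃ := h.le_dist (i + a + 1)
  have h₄ := hδ (x (i + a + 1)) (x i) (x (i + a + 1 + (b + 1) + 1)) (x (i + a + 2))
  have h₅ := gp_add_gp (x (i + a + 1)) (x (i + a + 2)) (x (i + a + 1 + (b + 1) + 1))
  rw [show i + a + 1 + b + 2 = i + a + 1 + (b + 1) + 1 by ring,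
    show i + a + 1 + 1 = i + a + 2 by ring] at h₂
  rw [show i + a + 1 + 1 = i + a + 2 by ring] at h₃
  rw [gp_comm (x (i + a + 1)) (x (i + a + 1 + (b + 1) + 1)) (x (i + a + 2))] at h₄
  simp only [min_le_iff] at h₄
  rcases h₄ with h₄ | h₄
  · linarith
  · linarith

/-- The terms $c$ telescope, so over whole periods of a periodic chain they cancel and linear growth
remains. -/
lemma IsChain.le_dist_add (hδ : FourPoint X δ) (h : IsChain δ x c) (i k : ℕ) :
    c (i + k) - c i + k ≤ dist (x i) (x (i + k)) := by
  have h0 := hδ.nonneg (x 0)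
  induction k with
  | zero => simp
  | succ k ih =>
    have h₁ := h.le_dist (i + k)
    rcases Nat.eq_zero_or_pos k with rfl | hk
    · have h₂ := h.nonneg i
      simp only [add_zero, zero_add, Nat.cast_one] at *
      linarith
    obtain ⟨k, rfl⟩ : ∃ k', k = k' + 1 := ⟨k - 1, by omega⟩
    have h₂ := h.gp_succ_le hδ i k
    have h₃ := dist_eq_gp (x (i + k + 1)) (x i) (x (i + k + 2))
    simp only [← add_assoc] at *
    rw [show i + k + 1 + 1 = i + k + 2 by ring] at *
    rw [dist_comm (x (i + k + 1)) (x i)] at h₃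
    push_cast at *
    linarith

end Chains

/-! ### Loxodromic elements and their quasi-axes. -/

lemma bddBelow_range_div_nat {u : ℕ → ℝ} (hu : ∀ n, 0 ≤ u n) :
    BddBelow (Set.range fun n : ℕ => u n / n) :=
  ⟨0, by rintro _ ⟨n, rfl⟩; exact div_nonneg (hu n) n.cast_nonneg⟩

section Loxodromic

variable {G : Type*} [Group G] {X : Type*} [MetricSpace X] [MulAction G X] [IsIsometricSMul G X]

lemma gp_smul_base (g : G) (w x y : X) : gp (g • w) x y = gp w (g⁻¹ • x) (g⁻¹ • y) := by
  rw [← gp_smul g w, smul_inv_smul, smul_inv_smul]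

lemma dist_smul_inv (o : X) (g : G) : dist o (g⁻¹ • o) = dist o (g • o) := by
  rw [← dist_smul g o, smul_inv_smul, dist_comm]

lemma dist_mul_smul_le (o : X) (g h : G) :
    dist o ((g * h) • o) ≤ dist o (g • o) + dist o (h • o) := by
  have := dist_triangle o (g • o) ((g * h) • o)
  rwa [mul_smul, dist_smul, ← mul_smul] at this

lemma dist_pow_smul_le (o : X) (g : G) (n : ℕ) : dist o (g ^ n • o) ≤ n * dist o (g • o) := by
  induction n with
  | zero => simp
  | succ n ih =>
    have := dist_mul_smul_le o (g ^ n) g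
    rw [pow_succ]; push_cast; linarith

lemma isChain_walk {δ : ℝ} {o : X} {T : ℕ → G} {c : ℕ → ℝ} (h0 : ∀ i, 0 ≤ c i)
    (hgp : ∀ i, gp o ((T i)⁻¹ • o) (T (i + 1) • o) ≤ c (i + 1))
    (hd : ∀ i, c i + c (i + 1) + 3 * δ + 1 ≤ dist o (T i • o)) :
    IsChain δ (fun i => walk T i • o) c where
  nonneg := h0
  gp_le i := by
    refine le_trans (le_of_eq ?_) (hgp i)
    simp only [walk]
    rw [gp_smul_base]
    congr 1
    · rw [← mul_smul]; congr 1; group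
    · rw [← mul_smul]; congr 1; group
  le_dist i := by
    refine (hd i).trans (le_of_eq ?_)
    simp only [walk]
    rw [mul_smul, dist_smul]

lemma walk_const (g : G) (n : ℕ) : walk (fun _ => g) n = g ^ n := by
  induction n with
  | zero => simp [walk]
  | succ n ih => rw [walk, ih, pow_succ]

lemma subadditive_dist_pow (o : X) (g : G) : Subadditive fun n : ℕ => dist (g ^ n • o) o := by
  intro m n
  have := dist_mul_smul_le o (g ^ m) (g ^ n)
  rw [← pow_add] at this
  simpa only [dist_comm] using this

lemma isLoxodromic_of_linear_growth {o : X} {g : G} {κ C : ℝ} (hκ : 0 < κ)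
    (h : ∀ n : ℕ, κ * n - C ≤ dist o (g ^ n • o)) : IsLoxodromic X g := by
  have ht := (subadditive_dist_pow o g).tendsto_lim (bddBelow_range_div_nat fun _ => dist_nonneg)
  refine ⟨(subadditive_dist_pow o g).lim, ?_, fun x => ?_⟩
  · refine lt_of_lt_of_le hκ ?_
    have h₁ : Tendsto (fun n : ℕ => κ - C / n) atTop (𝓝 (κ - 0)) :=
      tendsto_const_nhds.sub (tendsto_const_div_atTop_nhds_zero_nat C)
    rw [sub_zero] at h₁
    refine le_of_tendsto_of_tendsto h₁ ht ?_
    filter_upwards [eventually_gt_atTop 0] with n hn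
    have hn' : (0 : ℝ) < n := by exact_mod_cast hn
    rw [le_div_iff₀ hn', sub_mul, div_mul_cancel₀ _ hn'.ne', dist_comm]
    exact h n
  · have h₁ : Tendsto (fun n : ℕ => (2 * dist x o) / n) atTop (𝓝 0) :=
      tendsto_const_div_atTop_nhds_zero_nat _
    refine tendsto_of_tendsto_of_dist ht (squeeze_zero (fun _ => dist_nonneg) (fun n => ?_) h₁)
    rw [Real.dist_eq, ← sub_div, abs_div, Nat.abs_cast]
    gcongr
    have h₂ := dist_triangle4 (g ^ n • x) (g ^ n • o) o x
    have h₃ := dist_triangle4 (g ^ n • o) (g ^ n • x) x o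
    rw [dist_smul] at h₂ h₃
    rw [dist_comm o x] at *
    rw [abs_le]
    constructor <;> linarith

lemma IsLoxodromic.exists_linear_growth {g : G} (hg : IsLoxodromic X g) (o : X) :
    ∃ τ > 0, ∀ n : ℕ, τ * n ≤ dist o (g ^ n • o) := by
  obtain ⟨τ, hτ, ht⟩ := hg
  have h := (subadditive_dist_pow o g).tendsto_lim (bddBelow_range_div_nat fun _ => dist_nonneg)
  have e := tendsto_nhds_unique (ht o) h
  refine ⟨τ, hτ, fun n => ?_⟩
  rcases Nat.eq_zero_or_pos n with rfl | hn
  · simp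
  have := (subadditive_dist_pow o g).lim_le_div (bddBelow_range_div_nat fun _ => dist_nonneg) hn.ne'
  rw [← e, le_div_iff₀ (by exact_mod_cast hn)] at this
  rwa [dist_comm]

lemma IsLoxodromic.inv {g : G} (hg : IsLoxodromic X g) : IsLoxodromic X g⁻¹ := by
  obtain ⟨τ, hτ, ht⟩ := hg
  refine ⟨τ, hτ, fun x => ?_⟩
  refine (ht x).congr fun n => ?_
  rw [inv_pow, dist_comm _ x, dist_comm _ x, dist_smul_inv]

/-- Otherwise the displacement of $g^{2^k}$ would be at most linear in $k$, against its linear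
growth in $2^k$. The gain $K$ is what makes the powers of $g^N$ a chain. -/
lemma IsLoxodromic.exists_doubling {g : G} (hg : IsLoxodromic X g) (o : X) (K : ℝ) :
    ∃ N : ℕ, 0 < N ∧ dist o (g ^ N • o) + K ≤ dist o (g ^ (2 * N) • o) := by
  obtain ⟨τ, hτ, h⟩ := hg.exists_linear_growth o
  by_contra! hcon
  have hk : ∀ k : ℕ, dist o (g ^ (2 ^ k) • o) ≤ dist o (g • o) + k * K := by
    intro k
    induction k with
    | zero => simp
    | succ k ih =>
      have := hcon (2 ^ k) (by positivity)
      rw [pow_succ', Nat.cast_succ]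
      linarith
  have h₁ : Tendsto (fun k : ℕ => dist o (g • o) * ((k : ℝ) ^ 0 / 2 ^ k) +
      K * ((k : ℝ) ^ 1 / 2 ^ k)) atTop (𝓝 (dist o (g • o) * 0 + K * 0)) :=
    ((tendsto_pow_const_div_const_pow_of_one_lt 0 one_lt_two).const_mul _).add
      ((tendsto_pow_const_div_const_pow_of_one_lt 1 one_lt_two).const_mul _)
  rw [mul_zero, mul_zero, add_zero] at h₁
  refine absurd (ge_of_tendsto' h₁ (b := τ) fun k => ?_) (not_le.2 hτ)
  have h₂ := (h (2 ^ k)).trans (hk k)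
  push_cast at h₂
  have h₃ : (0 : ℝ) < 2 ^ k := by positivity
  rw [pow_zero, pow_one]
  field_simp
  linarith

/-- The orbit of a loxodromic element is uniformly close to the geodesics between its points. -/
lemma IsLoxodromic.exists_gp_le {δ : ℝ} (hδ : FourPoint X δ) {g : G} (hg : IsLoxodromic X g)
    (o : X) : ∃ C, 0 ≤ C ∧ ∀ i n : ℕ, i ≤ n → gp (g ^ i • o) o (g ^ n • o) ≤ C := by
  obtain ⟨N, hN, hd⟩ := hg.exists_doubling o (3 * δ + 1)
  have hδ0 := hδ.nonneg o
  set c := gp o ((g ^ N)⁻¹ • o) (g ^ N • o) with hc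
  have hc0 : 0 ≤ c := gp_nonneg _ _ _
  -- Here $d(o,g^No)-2c=d(o,g^{2N}o)-d(o,g^No)$, so the doubling estimate is exactly the step
  -- condition of a chain with constant $c$.
  have hc2 : 2 * c + 3 * δ + 1 ≤ dist o (g ^ N • o) := by
    have e : dist ((g ^ N)⁻¹ • o) (g ^ N • o) = dist o (g ^ (2 * N) • o) := by
      rw [← dist_smul (g ^ N), smul_inv_smul, ← mul_smul, ← pow_add, two_mul]
    rw [hc, gp, dist_smul_inv, e]
    linarith
  have chain : IsChain δ (fun i => walk (fun _ => g ^ N) i • o) (fun _ => c) :=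
    isChain_walk (fun _ => hc0) (fun _ => le_rfl) (fun _ => by linarith)
  simp only [walk_const] at chain
  have base : ∀ r q : ℕ, r ≤ q → gp ((g ^ N) ^ r • o) o ((g ^ N) ^ q • o) ≤ c + 2 * δ := by
    intro r q hrq
    rcases Nat.eq_zero_or_pos r with rfl | hr
    · simp only [pow_zero, one_smul, gp, dist_self]; linarith
    rcases hrq.eq_or_lt with rfl | hrq
    · simp only [gp, dist_self, dist_comm]; linarith
    simpa using chain.gp_le_of_lt hδ hr hrq
  set B := N * dist o (g • o)
  have hB : 0 ≤ B := by positivity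
  -- An arbitrary exponent is rounded down to a multiple of $N$, at bounded cost.
  have near : ∀ i : ℕ, dist (g ^ i • o) ((g ^ N) ^ (i / N) • o) ≤ B := by
    intro i
    rw [← pow_mul]
    conv_lhs => rw [← Nat.div_add_mod i N]
    rw [Nat.mul_add_div hN, Nat.mod_div_self, add_zero, pow_add, mul_smul, dist_smul, dist_comm]
    refine (dist_pow_smul_le o g _).trans ?_
    have : ((i % N : ℕ) : ℝ) ≤ N := by exact_mod_cast (Nat.mod_lt i hN).le
    exact mul_le_mul_of_nonneg_right this dist_nonneg
  refine ⟨c + 2 * δ + 2 * B, by positivity, fun i n hin => ?_⟩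
  have h₁ := gp_le_add_base (g ^ i • o) ((g ^ N) ^ (i / N) • o) o (g ^ n • o)
  have h₂ := gp_le_add_right ((g ^ N) ^ (i / N) • o) o (g ^ n • o) ((g ^ N) ^ (n / N) • o)
  have h₃ := base (i / N) (n / N) (Nat.div_le_div_right hin)
  have h₄ := near i
  have h₅ := near n
  linarith

end Loxodromic

/-! ### Boundary fixed points and transversality of independent loxodromics. -/

section Boundary

variable {G : Type*} [Group G] {X : Type*} [MetricSpace X] [MulAction G X] [IsIsometricSMul G X]

lemma dist_pow_smul_pow_smul (o : X) (g : G) {i j : ℕ} (h : i ≤ j) :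
    dist (g ^ i • o) (g ^ j • o) = dist o (g ^ (j - i) • o) := by
  conv_lhs => rw [← Nat.add_sub_cancel' h, pow_add, mul_smul, dist_smul]

/-- The quasigeodesic ray spanned by the positive powers of a loxodromic element. -/
def orbitRay {g : G} (hg : IsLoxodromic X g) (o : X) : QuasigeodesicRay X :=
  ⟨fun t => g ^ ⌊t⌋₊ • o, by
    obtain ⟨τ, hτ, h⟩ := hg.exists_linear_growth o
    set A := dist o (g • o)
    have hA : 0 ≤ A := dist_nonneg
    refine ⟨1 + 1 / τ + A, τ + A, by have := one_div_pos.2 hτ; linarith, by linarith, ?_⟩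
    have key : ∀ s t : ℝ≥0, s ≤ t → dist s t / (1 + 1 / τ + A) - (τ + A) ≤
        dist (g ^ ⌊s⌋₊ • o) (g ^ ⌊t⌋₊ • o) ∧ dist (g ^ ⌊s⌋₊ • o) (g ^ ⌊t⌋₊ • o) ≤
        (1 + 1 / τ + A) * dist s t + (τ + A) := by
      intro s t hst
      have hfl : ⌊s⌋₊ ≤ ⌊t⌋₊ := Nat.floor_mono hst
      rw [dist_pow_smul_pow_smul o g hfl]
      have h₁ := h (⌊t⌋₊ - ⌊s⌋₊)
      have h₂ := dist_pow_smul_le o g (⌊t⌋₊ - ⌊s⌋₊)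
      rw [Nat.cast_sub hfl] at h₁ h₂
      have s₁ : ((⌊s⌋₊ : ℕ) : ℝ) ≤ s := by exact_mod_cast Nat.floor_le (zero_le : 0 ≤ s)
      have t₁ : ((⌊t⌋₊ : ℕ) : ℝ) ≤ t := by exact_mod_cast Nat.floor_le (zero_le : 0 ≤ t)
      have s₂ : (s : ℝ) < ⌊s⌋₊ + 1 := by exact_mod_cast Nat.lt_floor_add_one s
      have t₂ : (t : ℝ) < ⌊t⌋₊ + 1 := by exact_mod_cast Nat.lt_floor_add_one t
      have hd : dist s t = (t : ℝ) - s := by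
        rw [NNReal.dist_eq, abs_sub_comm, abs_of_nonneg (sub_nonneg.2 (by exact_mod_cast hst))]
      rw [hd]
      have hst' : (0 : ℝ) ≤ (t : ℝ) - s := sub_nonneg.2 (by exact_mod_cast hst)
      constructor
      · have e : ((t : ℝ) - s) / (1 + 1 / τ + A) ≤ τ * (t - s) := by
          rw [div_le_iff₀ (by positivity)]
          have : τ * (t - s) * (1 + 1 / τ + A) = (t - s) + τ * (t - s) * (1 + A) := by
            field_simp; ring
          rw [this]
          have : 0 ≤ τ * (t - s) * (1 + A) := by positivity
          linarith
        nlinarith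
      · have h₃ : A * ((⌊t⌋₊ : ℝ) - ⌊s⌋₊) ≤ A * ((t - s) + 1) := by gcongr; linarith
        have h₄ : 0 ≤ (1 + 1 / τ) * (t - s) := by positivity
        linarith
    intro s t
    rcases le_total s t with hst | hst
    · exact key s t hst
    · rw [dist_comm s t, dist_comm (g ^ ⌊s⌋₊ • o)]
      exact key t s hst⟩

lemma range_orbitRay {g : G} (hg : IsLoxodromic X g) (o : X) :
    Set.range (orbitRay hg o).1 = Set.range fun n : ℕ => g ^ n • o := by
  ext y
  constructor
  · rintro ⟨t, rfl⟩; exact ⟨⌊t⌋₊, rfl⟩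
  · rintro ⟨n, rfl⟩
    refine ⟨n, ?_⟩
    change g ^ ⌊(n : ℝ≥0)⌋₊ • o = _
    rw [Nat.floor_natCast]

lemma hausdorffEDist_ne_top_of_dist_le {s t : Set X} {D : ℝ}
    (h₁ : ∀ x ∈ s, ∃ y ∈ t, dist x y ≤ D) (h₂ : ∀ x ∈ t, ∃ y ∈ s, dist x y ≤ D) :
    Metric.hausdorffEDist s t ≠ ⊤ := by
  refine ne_top_of_le_ne_top (b := ENNReal.ofReal D) ENNReal.ofReal_ne_top ?_
  refine Metric.hausdorffEDist_le_of_mem_edist (fun x hx => ?_) (fun x hx => ?_)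
  · obtain ⟨y, hy, h⟩ := h₁ x hx
    exact ⟨y, hy, by rw [edist_dist]; exact ENNReal.ofReal_le_ofReal h⟩
  · obtain ⟨y, hy, h⟩ := h₂ x hx
    exact ⟨y, hy, by rw [edist_dist]; exact ENNReal.ofReal_le_ofReal h⟩

lemma mk_orbitRay_mem_boundaryFix {g : G} (hg : IsLoxodromic X g) (o : X) :
    (Quotient.mk (asymptoticSetoid X) (orbitRay hg o)) ∈ boundaryFix X g := by
  change Quotient.mk (asymptoticSetoid X) (QuasigeodesicRay.translate g (orbitRay hg o)) =
    Quotient.mk (asymptoticSetoid X) (orbitRay hg o)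
  refine Quotient.sound ?_
  change Metric.hausdorffEDist _ _ ≠ ⊤
  have e : Set.range (QuasigeodesicRay.translate g (orbitRay hg o)).1 =
      Set.range fun n : ℕ => g • g ^ n • o := by
    have : (QuasigeodesicRay.translate g (orbitRay hg o)).1 =
        (fun x : X => g • x) ∘ (orbitRay hg o).1 := rfl
    rw [this, Set.range_comp, range_orbitRay, ← Set.range_comp]; rfl
  rw [e, range_orbitRay]
  refine hausdorffEDist_ne_top_of_dist_le (D := dist o (g • o)) ?_ ?_
  · rintro _ ⟨n, rfl⟩
    refine ⟨_, ⟨n + 1, rfl⟩, ?_⟩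
    simp only [pow_succ', mul_smul, dist_self]; exact dist_nonneg
  · rintro _ ⟨n, rfl⟩
    refine ⟨_, ⟨n, rfl⟩, ?_⟩
    simp only
    rw [← mul_smul, ← pow_succ', pow_succ, mul_smul, dist_smul]

lemma boundaryMap_one_apply (ξ : GromovBoundary X) : boundaryMap (1 : G) ξ = ξ := by
  induction ξ using Quotient.inductionOn with
  | _ γ =>
    change Quotient.mk (asymptoticSetoid X) _ = Quotient.mk (asymptoticSetoid X) _
    congr 1
    exact Subtype.ext (funext fun t => one_smul G _)

lemma boundaryMap_mul_apply (g h : G) (ξ : GromovBoundary X) :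
    boundaryMap (g * h) ξ = boundaryMap g (boundaryMap h ξ) := by
  induction ξ using Quotient.inductionOn with
  | _ γ =>
    change Quotient.mk (asymptoticSetoid X) _ = Quotient.mk (asymptoticSetoid X) _
    congr 1
    exact Subtype.ext (funext fun t => mul_smul g h _)

lemma boundaryFix_inv (g : G) : boundaryFix X g⁻¹ = boundaryFix X g := by
  have key : ∀ g : G, boundaryFix X g ⊆ boundaryFix X g⁻¹ := by
    intro g ξ hξ
    change boundaryMap g ξ = ξ at hξ
    change boundaryMap g⁻¹ ξ = ξ
    conv_lhs => rw [← hξ, ← boundaryMap_mul_apply, inv_mul_cancel, boundaryMap_one_apply]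
  refine Set.Subset.antisymm ?_ (key g)
  simpa using key g⁻¹

/-- If the Gromov products of two quasi-axes are unbounded, then the first one stays close to the
second one. -/
lemma exists_dist_pow_smul_le {δ : ℝ} (hδ : FourPoint X δ) {o : X} {a b : G} {A B : ℝ}
    (hA0 : 0 ≤ A) (hB0 : 0 ≤ B)
    (hA : ∀ i n : ℕ, i ≤ n → gp (a ^ i • o) o (a ^ n • o) ≤ A)
    (hB : ∀ i n : ℕ, i ≤ n → gp (b ^ i • o) o (b ^ n • o) ≤ B)
    (hab : ∀ C : ℝ, ∃ n m : ℕ, C < gp o (a ^ n • o) (b ^ m • o)) (i : ℕ) :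
    ∃ j : ℕ, dist (a ^ i • o) (b ^ j • o) ≤ dist o (b • o) + 2 * A + 2 * B + 4 * δ := by
  classical
  have hδ0 := hδ.nonneg o
  set r := dist o (a ^ i • o) with hr
  obtain ⟨n, m, hnm⟩ := hab (r + i * dist o (a • o))
  have hr0 : 0 ≤ r := dist_nonneg
  have hi0 : 0 ≤ i * dist o (a • o) := by positivity
  have hin : i ≤ n := by
    by_contra! hlt
    have h₁ := gp_le_dist_left o (a ^ n • o) (b ^ m • o)
    have h₂ := dist_pow_smul_le o a n
    have h₃ : (n : ℝ) * dist o (a • o) ≤ i * dist o (a • o) := by gcongr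
    linarith
  have hm : r ≤ dist o (b ^ m • o) := by
    have := gp_le_dist_right o (a ^ n • o) (b ^ m • o)
    linarith
  have hex : ∃ j, r ≤ dist o (b ^ j • o) := ⟨m, hm⟩
  set j := Nat.find hex with hj
  have hj₁ : r ≤ dist o (b ^ j • o) := Nat.find_spec hex
  have hjm : j ≤ m := Nat.find_min' hex hm
  have hj₂ : dist o (b ^ j • o) ≤ r + dist o (b • o) := by
    rcases Nat.eq_zero_or_pos j with h0 | hpos
    · rw [h0, pow_zero, one_smul, dist_self]; positivity
    · obtain ⟨l, hl⟩ : ∃ l, j = l + 1 := ⟨j - 1, by omega⟩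
      have h₁ : ¬ r ≤ dist o (b ^ l • o) := Nat.find_min hex (by omega)
      have h₂ := dist_mul_smul_le o (b ^ l) b
      rw [← pow_succ, ← hl] at h₂
      linarith
  refine ⟨j, ?_⟩
  have h₁ := hδ.min_le o (a ^ i • o) (a ^ n • o) (b ^ m • o) (b ^ j • o)
  have h₂ := gp_add_gp o (a ^ i • o) (a ^ n • o)
  have h₃ := gp_add_gp o (b ^ j • o) (b ^ m • o)
  have h₄ := hA i n hin
  have h₅ := hB j m hjm
  rw [gp_comm o (b ^ m • o) (b ^ j • o)] at h₁
  have h₆ := dist_eq_gp o (a ^ i • o) (b ^ j • o)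
  simp only [min_le_iff] at h₁
  rcases h₁ with h₁ | h₁ | h₁ <;> linarith

/-- If the products were unbounded, each forward orbit would stay near the other, so the two orbit
rays would define the same boundary point, fixed by both elements. -/
lemma exists_gp_pow_le {δ : ℝ} (hδ : FourPoint X δ) (o : X) {a b : G}
    (ha : IsLoxodromic X a) (hb : IsLoxodromic X b)
    (hdisj : Disjoint (boundaryFix X a) (boundaryFix X b)) :
    ∃ C : ℝ, ∀ n m : ℕ, gp o (a ^ n • o) (b ^ m • o) ≤ C := by
  by_contra! hcon
  obtain ⟨A, hA0, hA⟩ := ha.exists_gp_le hδ o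
  obtain ⟨B, hB0, hB⟩ := hb.exists_gp_le hδ o
  have h₁ := exists_dist_pow_smul_le hδ hA0 hB0 hA hB hcon
  have h₂ := exists_dist_pow_smul_le hδ hB0 hA0 hB hA fun C => by
    obtain ⟨n, m, h⟩ := hcon C
    exact ⟨m, n, by rwa [gp_comm]⟩
  have hδ0 := hδ.nonneg o
  have e : (Quotient.mk (asymptoticSetoid X) (orbitRay ha o)) =
      Quotient.mk (asymptoticSetoid X) (orbitRay hb o) := by
    refine Quotient.sound ?_
    change Metric.hausdorffEDist _ _ ≠ ⊤
    rw [range_orbitRay, range_orbitRay]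
    have ha0 : 0 ≤ dist o (a • o) := dist_nonneg
    have hb0 : 0 ≤ dist o (b • o) := dist_nonneg
    refine hausdorffEDist_ne_top_of_dist_le
      (D := dist o (a • o) + dist o (b • o) + 2 * A + 2 * B + 4 * δ) ?_ ?_
    · rintro _ ⟨n, rfl⟩
      obtain ⟨j, hj⟩ := h₁ n
      exact ⟨_, ⟨j, rfl⟩, by simp only; linarith⟩
    · rintro _ ⟨n, rfl⟩
      obtain ⟨j, hj⟩ := h₂ n
      exact ⟨_, ⟨j, rfl⟩, by simp only; linarith⟩
  refine Set.disjoint_left.1 hdisj (mk_orbitRay_mem_boundaryFix ha o) ?_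
  rw [e]
  exact mk_orbitRay_mem_boundaryFix hb o

/-- Uniform transversality of the four ends of two independent loxodromic elements. -/
lemma AreIndependentLoxodromic.exists_gp_le {δ : ℝ} (hδ : FourPoint X δ) (o : X) {a b : G}
    (h : AreIndependentLoxodromic X a b) :
    ∃ C : ℝ, 0 ≤ C ∧ ∀ n m : ℕ, gp o (a ^ n • o) (b ^ m • o) ≤ C ∧
      gp o (a⁻¹ ^ n • o) (b ^ m • o) ≤ C ∧ gp o (a ^ n • o) (b⁻¹ ^ m • o) ≤ C ∧
      gp o (a⁻¹ ^ n • o) (b⁻¹ ^ m • o) ≤ C := by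
  obtain ⟨ha, hb, hd⟩ := h
  obtain ⟨C₁, h₁⟩ := exists_gp_pow_le hδ o ha hb hd
  obtain ⟨C₂, h₂⟩ := exists_gp_pow_le hδ o ha.inv hb (by rwa [boundaryFix_inv])
  obtain ⟨C₃, h₃⟩ := exists_gp_pow_le hδ o ha hb.inv (by rwa [boundaryFix_inv])
  obtain ⟨C₄, h₄⟩ := exists_gp_pow_le hδ o ha.inv hb.inv
    (by rwa [boundaryFix_inv, boundaryFix_inv])
  have p₁ := (gp_nonneg _ _ _).trans (h₁ 0 0)
  have p₂ := (gp_nonneg _ _ _).trans (h₂ 0 0)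
  have p₃ := (gp_nonneg _ _ _).trans (h₃ 0 0)
  have p₄ := (gp_nonneg _ _ _).trans (h₄ 0 0)
  refine ⟨C₁ + C₂ + C₃ + C₄, by positivity, fun n m => ?_⟩
  have q₁ := h₁ n m
  have q₂ := h₂ n m
  have q₃ := h₃ n m
  have q₄ := h₄ n m
  refine ⟨?_, ?_, ?_, ?_⟩ <;> linarith

end Boundary

/-! ### Schottky families. -/

section Schottky

variable {G : Type*} [Group G] {X : Type*} [MetricSpace X] [MulAction G X] [IsIsometricSMul G X]

/-- A Schottky family: every point of `X` is in the direction of at most one of the `s i`, and of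
at most one of the `(s i)⁻¹`, and the `s i` have comparable lengths. -/
structure IsSchottky (o : X) (C D : ℝ) (s : Fin 12 → G) : Prop where
  unique : ∀ y i j, C < gp o y (s i • o) → C < gp o y (s j • o) → i = j
  unique_inv : ∀ y i j, C < gp o y ((s i)⁻¹ • o) → C < gp o y ((s j)⁻¹ • o) → i = j
  le_dist : ∀ i, D ≤ dist o (s i • o)
  dist_le : ∀ i, dist o (s i • o) ≤ 2 * D

/-- Since $g$ displaces $o$ a lot and $y$ is not in the direction of $g^{-1}o$, the point $gy$ lies
in the direction of $go$, which $y$ does not. -/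
lemma gp_smul_self_le {δ C : ℝ} (hδ : FourPoint X δ) {o y : X} {g : G}
    (h₁ : gp o (g⁻¹ • o) y ≤ C) (h₂ : gp o (g • o) y ≤ C) (hg : 2 * C + δ < dist o (g • o)) :
    gp o y (g • y) ≤ C + δ := by
  have e := gp_add_gp o (g • o) (g • y)
  rw [gp_smul_base, inv_smul_smul] at e
  have h := hδ o (g • o) (g • y) y
  rw [gp_comm o y]
  rcases min_le_iff.1 h with h | h <;> linarith

lemma gp_conj_pow_le {δ C E : ℝ} (hδ : FourPoint X δ) {o : X} {a b : G}
    {e l f f' q : ℕ} (h₁ : gp o (a⁻¹ ^ l • o) (b ^ q • o) ≤ C) (h₂ : gp o (a ^ l • o) (b ^ q • o) ≤ C)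
    (hl : 2 * C + δ < dist o (a ^ l • o)) (he : dist o (a ^ e • o) ≤ E)
    (hf : dist o (a ^ f • o) ≤ E) (hf' : dist o (a ^ f' • o) ≤ E) :
    gp o ((a ^ e * b ^ q * a ^ f) • o) ((a ^ (e + l) * b ^ q * a ^ f') • o) ≤ C + δ + 3 * E := by
  rw [inv_pow] at h₁
  have k₁ := gp_smul_self_le hδ h₁ h₂ hl
  have k₂ := gp_le_add_base o (a ^ e • o) ((a ^ e * b ^ q * a ^ f) • o)
    ((a ^ (e + l) * b ^ q * a ^ f') • o)
  have e₁ : (a ^ e)⁻¹ • (a ^ e * b ^ q * a ^ f) • o = (b ^ q * a ^ f) • o := by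
    rw [← mul_smul]; congr 1; group
  have e₂ : (a ^ e)⁻¹ • (a ^ (e + l) * b ^ q * a ^ f') • o = (a ^ l * b ^ q * a ^ f') • o := by
    rw [← mul_smul, pow_add]; congr 1; group
  rw [gp_smul_base, e₁, e₂] at k₂
  have k₃ := gp_le_add_left o ((b ^ q * a ^ f) • o) (b ^ q • o) ((a ^ l * b ^ q * a ^ f') • o)
  have k₄ := gp_le_add_right o (b ^ q • o) ((a ^ l * b ^ q * a ^ f') • o) ((a ^ l * b ^ q) • o)
  rw [mul_smul (b ^ q), dist_smul, dist_comm] at k₃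
  rw [mul_smul (a ^ l * b ^ q), dist_smul, dist_comm] at k₄
  rw [← mul_smul] at k₁
  simp only [mul_smul] at *
  linarith

/-- The members of the Schottky families built from `a` and `b`. -/
def schottkyElt (a b : G) (p q : ℕ) (i : Fin 12) : G :=
  a ^ ((i + 1) * p) * b ^ q * a ^ ((12 - i) * p)

/-- The initial power of $a$ separates the directions of the $s_io$, the final power those of the
$s_i^{-1}o$. The two exponents add up to $13p$ for every $i$, so all members are reached by the walk
after the same number of steps. The constant $C$ is fixed before $q$, so the lengths can be made
arbitrarily large compared to it. -/
lemma exists_isSchottky {δ : ℝ} (hδ : FourPoint X δ) (o : X) {a b : G}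
    (h : AreIndependentLoxodromic X a b) :
    ∃ (p : ℕ) (C : ℝ), 0 ≤ C ∧ ∀ D₀ : ℝ, ∃ (q : ℕ) (D : ℝ), D₀ ≤ D ∧
      IsSchottky o C D (schottkyElt a b p q) := by
  have hδ0 := hδ.nonneg o
  obtain ⟨C, hC0, hC⟩ := h.exists_gp_le hδ o
  obtain ⟨τ, hτ, ha⟩ := h.1.exists_linear_growth o
  obtain ⟨σ, hσ, hb⟩ := h.2.1.exists_linear_growth o
  -- With this $p$, distinct exponents of $a$ differ by a power that displaces $o$ by more than
  -- $2C+\delta$, as `gp_smul_self_le` requires.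
  obtain ⟨p, hp⟩ := exists_nat_gt ((2 * C + δ) / τ)
  rw [div_lt_iff₀ hτ] at hp
  set E := 13 * p * dist o (a • o) with hE
  have hE0 : 0 ≤ E := by positivity
  have hEa : ∀ k : ℕ, k ≤ 13 * p → dist o (a ^ k • o) ≤ E := by
    intro k hk
    refine (dist_pow_smul_le o a k).trans ?_
    rw [hE]
    gcongr
    exact_mod_cast hk
  have hfar : ∀ k : ℕ, 1 ≤ k → 2 * C + δ < dist o (a ^ (k * p) • o) := by
    intro k hk
    refine lt_of_lt_of_le ?_ (ha _)
    have : (p : ℝ) ≤ (k * p : ℕ) := by exact_mod_cast Nat.le_mul_of_pos_left p hk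
    nlinarith
  refine ⟨p, C + δ + 3 * E + δ, by positivity, fun D₀ => ?_⟩
  -- All lengths are within $2E$ of $d(o,b^qo)$. Taking $D=d(o,b^qo)-2E$, the upper bound $2D$ needs
  -- $d(o,b^qo)\ge 6E$.
  obtain ⟨q, hq⟩ := exists_nat_gt ((|D₀| + 6 * E) / σ)
  rw [div_lt_iff₀ hσ] at hq
  have hbq := hb q
  have hD₀ := le_abs_self D₀
  have hD₁ := abs_nonneg D₀
  have key : ∀ i j : Fin 12, i < j →
      gp o (schottkyElt a b p q i • o) (schottkyElt a b p q j • o) ≤ C + δ + 3 * E ∧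
      gp o ((schottkyElt a b p q i)⁻¹ • o) ((schottkyElt a b p q j)⁻¹ • o) ≤ C + δ + 3 * E := by
    intro i j hij
    have hij' : (i : ℕ) < j := hij
    have hj := j.2
    have b₁ : ((i : ℕ) + 1) * p ≤ 13 * p := Nat.mul_le_mul_right _ (by omega)
    have b₂ : (12 - (i : ℕ)) * p ≤ 13 * p := Nat.mul_le_mul_right _ (by omega)
    have b₃ : (12 - (j : ℕ)) * p ≤ 13 * p := Nat.mul_le_mul_right _ (by omega)
    have b₄ : ((j : ℕ) + 1) * p ≤ 13 * p := Nat.mul_le_mul_right _ (by omega)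
    have e₁ : ((j : ℕ) + 1) * p = (i + 1) * p + (j - i) * p := by
      rw [← add_mul]; congr 1; omega
    have e₂ : (12 - (i : ℕ)) * p = (12 - j) * p + (j - i) * p := by
      rw [← add_mul]; congr 1; omega
    have hl := hfar (j - i) (by omega)
    constructor
    · rw [schottkyElt, schottkyElt, e₁]
      exact gp_conj_pow_le hδ (hC _ _).2.1 (hC _ _).1 hl (hEa _ b₁) (hEa _ b₂) (hEa _ b₃)
    · have inv_eq : ∀ i : Fin 12, (schottkyElt a b p q i)⁻¹ =
          a⁻¹ ^ ((12 - (i : ℕ)) * p) * b⁻¹ ^ q * a⁻¹ ^ (((i : ℕ) + 1) * p) := by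
        intro i
        simp only [schottkyElt, mul_inv_rev, inv_pow, mul_assoc]
      have hinv : ∀ k, dist o (a⁻¹ ^ k • o) = dist o (a ^ k • o) := fun k => by
        rw [inv_pow, dist_smul_inv]
      rw [gp_comm, inv_eq, inv_eq, e₂]
      refine gp_conj_pow_le hδ ?_ (hC _ _).2.2.2 ?_ ?_ ?_ ?_
      · rw [inv_inv]; exact (hC _ _).2.2.1
      · rw [hinv]; exact hl
      · rw [hinv]; exact hEa _ b₃
      · rw [hinv]; exact hEa _ b₄
      · rw [hinv]; exact hEa _ b₁
  have uniq : ∀ (x : Fin 12 → X), (∀ i j, i < j → gp o (x i) (x j) ≤ C + δ + 3 * E) →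
      ∀ y i j, C + δ + 3 * E + δ < gp o y (x i) → C + δ + 3 * E + δ < gp o y (x j) → i = j := by
    intro x hx y
    have : ∀ i j, i < j → C + δ + 3 * E + δ < gp o y (x i) →
        ¬ C + δ + 3 * E + δ < gp o y (x j) := by
      intro i j hij h₁ h₂
      have h₃ := hδ o (x i) y (x j)
      have h₄ := hx i j hij
      rw [gp_comm] at h₁
      rcases min_le_iff.1 h₃ with h₃ | h₃ <;> linarith
    intro i j h₁ h₂
    rcases lt_trichotomy i j with hij | hij | hij
    · exact absurd h₂ (this i j hij h₁)
    · exact hij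
    · exact absurd h₁ (this j i hij h₂)
  have size : ∀ i, |dist o (schottkyElt a b p q i • o) - dist o (b ^ q • o)| ≤ 2 * E := by
    intro i
    have hi := i.2
    have b₁ := hEa (((i : ℕ) + 1) * p) (Nat.mul_le_mul_right _ (by omega))
    have b₂ := hEa ((12 - (i : ℕ)) * p) (Nat.mul_le_mul_right _ (by omega))
    set u := a ^ (((i : ℕ) + 1) * p)
    set v := a ^ ((12 - (i : ℕ)) * p)
    have e : schottkyElt a b p q i = u * b ^ q * v := rfl
    have t₁ := dist_mul_smul_le o (u * b ^ q) v
    have t₂ := dist_mul_smul_le o u (b ^ q)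
    have t₃ := dist_mul_smul_le o (u⁻¹ * (u * b ^ q * v)) v⁻¹
    have t₄ := dist_mul_smul_le o u⁻¹ (u * b ^ q * v)
    rw [show u⁻¹ * (u * b ^ q * v) * v⁻¹ = b ^ q by group] at t₃
    rw [dist_smul_inv] at t₃ t₄
    rw [e, abs_le]
    constructor <;> linarith
  refine ⟨q, dist o (b ^ q • o) - 2 * E, by linarith, ?_, ?_, ?_, ?_⟩
  · exact uniq _ fun i j hij => (key i j hij).1
  · exact uniq _ fun i j hij => (key i j hij).2
  · intro i; linarith [(abs_le.1 (size i)).1]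
  · intro i; linarith [(abs_le.1 (size i)).2]

/-- Averaged over a Schottky family, inserting a member at `o` moves any point away from `o`. -/
lemma IsSchottky.sum_dist_ge {δ C D : ℝ} (hδ : FourPoint X δ) {o : X} {s : Fin 12 → G}
    (hs : IsSchottky o C D s) (hC : 0 ≤ C) (hD : 40 * C + 40 * δ + 40 ≤ D) (y x : X) :
    12 * (dist y o + 1) ≤ ∑ i, dist y (s i • x) := by
  classical
  have hδ0 := hδ.nonneg o
  set t := dist o x with ht
  have ht0 : 0 ≤ t := dist_nonneg
  -- At most two indices are bad. A good one gains about $D+t$ and a bad one loses at most $2D+t$,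
  -- so any family of more than six members would do for $D$ large.
  let bad : Finset (Fin 12) := Finset.univ.filter fun i =>
    C < gp o y (s i • o) ∨ C < gp o x ((s i)⁻¹ • o)
  have hbad : bad.card ≤ 2 := by
    have h₁ : bad ⊆ (Finset.univ.filter fun i => C < gp o y (s i • o)) ∪
        (Finset.univ.filter fun i => C < gp o x ((s i)⁻¹ • o)) := by
      intro i hi
      simpa [bad] using hi
    refine (Finset.card_le_card h₁).trans ((Finset.card_union_le _ _).trans ?_)
    have h₂ : (Finset.univ.filter fun i => C < gp o y (s i • o)).card ≤ 1 := by
      refine Finset.card_le_one.2 fun i hi j hj => ?_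
      simp only [Finset.mem_filter, Finset.mem_univ, true_and] at hi hj
      exact hs.unique y i j hi hj
    have h₃ : (Finset.univ.filter fun i => C < gp o x ((s i)⁻¹ • o)).card ≤ 1 := by
      refine Finset.card_le_one.2 fun i hi j hj => ?_
      simp only [Finset.mem_filter, Finset.mem_univ, true_and] at hi hj
      exact hs.unique_inv x i j hi hj
    omega
  have hgood : ∀ i, i ∉ bad → dist y o + (D + t - 4 * C - 2 * δ) ≤ dist y (s i • x) := by
    intro i hi
    simp only [bad, Finset.mem_filter, Finset.mem_univ, true_and, not_or, not_lt] at hi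
    have e₁ := dist_eq_gp o y (s i • o)
    have e₂ := dist_eq_gp (s i • o) y (s i • x)
    have e₃ := hδ (s i • o) o y (s i • x)
    have e₄ : gp (s i • o) o (s i • x) = gp o x ((s i)⁻¹ • o) := by
      rw [gp_smul_base, inv_smul_smul, gp_comm]
    have e₅ := gp_add_gp o (s i • o) y
    rw [gp_comm] at e₅
    rw [dist_smul] at e₂
    have := hs.le_dist i
    have h₆ := hi.1
    have h₇ := hi.2
    rw [dist_comm o y] at e₁
    rw [dist_comm (s i • o) y] at e₂
    rcases min_le_iff.1 e₃ with e₃ | e₃ <;> linarith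
  have hall : ∀ i, dist y o - (2 * D + t) ≤ dist y (s i • x) := by
    intro i
    have h₁ := dist_triangle y (s i • x) o
    have h₂ := dist_triangle o (s i • o) (s i • x)
    rw [dist_smul] at h₂
    rw [dist_comm (s i • x) o] at h₁
    have := hs.dist_le i
    linarith
  have hpt : ∀ i, dist y o + (D + t - 4 * C - 2 * δ) -
      (if i ∈ bad then 3 * D + 2 * t else 0) ≤ dist y (s i • x) := by
    intro i
    split_ifs with hi
    · have := hall i; linarith
    · have := hgood i hi; linarith
  have hsum := Finset.sum_le_sum fun i (_ : i ∈ Finset.univ) => hpt i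
  rw [Finset.sum_sub_distrib, Finset.sum_const, Finset.card_univ, Fintype.card_fin, nsmul_eq_mul,
    Finset.sum_ite_mem, Finset.univ_inter, Finset.sum_const, nsmul_eq_mul] at hsum
  have hcard : (bad.card : ℝ) ≤ 2 := by exact_mod_cast hbad
  have h₈ : (bad.card : ℝ) * (3 * D + 2 * t) ≤ 2 * (3 * D + 2 * t) := by
    apply mul_le_mul_of_nonneg_right hcard
    linarith
  push_cast at hsum
  linarith

end Schottky

/-! ### A criterion for being WPD. -/

section Criterion

variable {G : Type*} [Group G] {X : Type*} [MetricSpace X] [MulAction G X] [IsIsometricSMul G X]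

/-- Both points are near a geodesic from $o$ to $y$, so their positions are determined by their
distances to $o$. -/
lemma dist_le_of_gp_le {δ A : ℝ} (hδ : FourPoint X δ) {o y p q : X} (hp : gp p o y ≤ A)
    (hq : gp q o y ≤ A) : dist p q ≤ |dist o p - dist o q| + 2 * A + 2 * δ := by
  have h₁ := hδ o p y q
  have h₂ := gp_add_gp o p y
  have h₃ := gp_add_gp o q y
  have h₄ := dist_eq_gp o p q
  have h₅ := abs_le.1 (le_refl |dist o p - dist o q|)
  rw [gp_comm o y q] at h₁
  rcases min_le_iff.1 h₁ with h₁ | h₁ <;> linarith [h₅.1, h₅.2]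

lemma dist_sub_dist_le_gp (w x y : X) : dist w x - dist x y ≤ gp w x y := by
  have := dist_triangle w y x
  rw [dist_comm y x] at this
  simp only [gp]; linarith

lemma abs_dist_smul_sub_le {o p : X} {f : G} {K : ℝ} (hf : dist o (f • o) ≤ K) :
    |dist o (f • p) - dist o p| ≤ K := by
  have h₁ := abs_dist_sub_le o (f • o) (f • p)
  rw [dist_smul] at h₁
  exact h₁.trans hf

/-- An isometry which moves two points a little does not move the points well inside the segment
between them away from that segment. -/
lemma gp_smul_le_of_far {δ A K : ℝ} (hδ : FourPoint X δ) {o y p : X} {f : G}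
    (ho : dist o (f • o) ≤ K) (hy : dist y (f • y) ≤ K) (hp : gp p o y ≤ A)
    (hpo : K + A + 2 * δ < dist p o) (hpy : K + A + 2 * δ < dist p y) :
    gp (f • p) o y ≤ A + 2 * δ := by
  rw [gp_smul_base]
  have h₁ := hδ.min_le p o (f⁻¹ • o) (f⁻¹ • y) y
  have h₂ := dist_sub_dist_le_gp p o (f⁻¹ • o)
  have h₃ := dist_sub_dist_le_gp p y (f⁻¹ • y)
  rw [dist_smul_inv] at h₂ h₃
  rw [gp_comm p (f⁻¹ • y) y] at h₁
  simp only [min_le_iff] at h₁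
  rcases h₁ with h₁ | h₁ | h₁ <;> linarith

lemma jointCoarseStab_smul_finite {K : ℝ} {x y : X} (h : (jointCoarseStab G K x y).Finite)
    (g : G) : (jointCoarseStab G K (g • x) (g • y)).Finite := by
  refine (h.image fun f => g * f * g⁻¹).subset fun f hf => ⟨g⁻¹ * f * g, ?_, by group⟩
  have e : ∀ z : X, dist z ((g⁻¹ * f * g) • z) = dist (g • z) (f • g • z) := fun z => by
    rw [← dist_smul g z, ← mul_smul, ← mul_smul]; congr 2; group
  exact ⟨by rw [e]; exact hf.1, by rw [e]; exact hf.2⟩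

/-- Finiteness of a joint coarse stabilizer passes to long segments around the given one, for an
arbitrary constant. -/
lemma jointCoarseStab_finite_of_far {δ A K : ℝ} (hδ : FourPoint X δ) {o y p q : X}
    (h : (jointCoarseStab G (2 * (A + 2 * δ) + 2 * δ + 1) p q).Finite)
    (hp : gp p o y ≤ A) (hq : gp q o y ≤ A)
    (hpo : K + A + 2 * δ < dist p o) (hpy : K + A + 2 * δ < dist p y)
    (hqo : K + A + 2 * δ < dist q o) (hqy : K + A + 2 * δ < dist q y) :
    (jointCoarseStab G K o y).Finite := by
  -- The elements are sorted by the rounded distances from $o$ to the images of $p$ and $q$: there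
  -- are finitely many classes, and $f_1^{-1}f$ moves $p$ and $q$ by less than a constant
  -- independent of $K$ when $f$ and $f_1$ are in the same class.
  let φ : G → ℤ × ℤ := fun f => (⌊dist o (f • p)⌋, ⌊dist o (f • q)⌋)
  have himage : (φ '' jointCoarseStab G K o y).Finite := by
    refine ((Set.finite_Icc ⌊dist o p - K⌋ ⌊dist o p + K⌋).prod
      (Set.finite_Icc ⌊dist o q - K⌋ ⌊dist o q + K⌋)).subset ?_
    rintro _ ⟨f, hf, rfl⟩
    have h₁ := abs_le.1 (abs_dist_smul_sub_le (p := p) hf.1)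
    have h₂ := abs_le.1 (abs_dist_smul_sub_le (p := q) hf.1)
    exact ⟨⟨Int.floor_mono (by linarith), Int.floor_mono (by linarith)⟩,
      ⟨Int.floor_mono (by linarith), Int.floor_mono (by linarith)⟩⟩
  refine Set.Finite.of_finite_fibers φ himage ?_
  rintro _ ⟨f₁, hf₁, rfl⟩
  refine (h.image fun f => f₁ * f).subset ?_
  rintro f ⟨hf, hff⟩
  have hff : φ f = φ f₁ := hff
  refine ⟨f₁⁻¹ * f, ?_, by group⟩
  have near : ∀ z : X, gp z o y ≤ A → K + A + 2 * δ < dist z o → K + A + 2 * δ < dist z y →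
      ⌊dist o (f • z)⌋ = ⌊dist o (f₁ • z)⌋ →
      dist z ((f₁⁻¹ * f) • z) ≤ 2 * (A + 2 * δ) + 2 * δ + 1 := by
    intro z hz hzo hzy hfl
    rw [← dist_smul f₁, ← mul_smul, mul_inv_cancel_left]
    have h₁ := gp_smul_le_of_far hδ hf.1 hf.2 hz hzo hzy
    have h₂ := gp_smul_le_of_far hδ hf₁.1 hf₁.2 hz hzo hzy
    have h₃ := dist_le_of_gp_le hδ h₂ h₁
    have h₄ := Int.abs_sub_lt_one_of_floor_eq_floor hfl
    rw [abs_sub_comm] at h₄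
    linarith
  exact ⟨near p hp hpo hpy (congrArg Prod.fst hff), near q hq hqo hqy (congrArg Prod.snd hff)⟩

/-- The definition gives no control on the exponent. Moving $o$ and $h^{M+n}o$ by at most $K$ forces
a bounded displacement of the intermediate point $h^Mo$, so finiteness at $M$ for a larger constant
passes to every larger exponent. -/
lemma IsWPD.exists_pow {δ : ℝ} (hδ : FourPoint X δ) {h : G} (hh : IsWPD X h) (o : X)
    {K : ℝ} (hK : 0 ≤ K) (B : ℝ) :
    ∃ M : ℕ, (jointCoarseStab G K o (h ^ M • o)).Finite ∧ B ≤ dist o (h ^ M • o) := by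
  have hδ0 := hδ.nonneg o
  obtain ⟨C, hC0, hC⟩ := hh.1.exists_gp_le hδ o
  obtain ⟨τ, hτ, ht⟩ := hh.1.exists_linear_growth o
  obtain ⟨M, -, hM⟩ := hh.2 (5 * K + 2 * C + 2 * δ) (by positivity) o
  obtain ⟨n, hn⟩ := exists_nat_ge (B / τ)
  rw [div_le_iff₀ hτ] at hn
  refine ⟨M + n, hM.subset fun f hf => ?_, ?_⟩
  · refine ⟨hf.1.trans (by linarith), ?_⟩
    set p := h ^ M • o
    set y := h ^ (M + n) • o
    have h₁ : gp p o y ≤ C := hC M (M + n) (by omega)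
    have h₂ : gp (f • p) o y ≤ C + 2 * K := by
      rw [gp_smul_base]
      have k₁ := gp_le_add_left p (f⁻¹ • o) o (f⁻¹ • y)
      have k₂ := gp_le_add_right p o (f⁻¹ • y) y
      have k₃ := hf.1
      have k₄ := hf.2
      rw [dist_comm, dist_smul_inv] at k₁ k₂
      linarith
    have h₃ := dist_le_of_gp_le hδ (h₁.trans (by linarith : C ≤ C + 2 * K)) h₂
    have h₄ := abs_dist_smul_sub_le (p := p) hf.1
    rw [abs_sub_comm] at h₄
    linarith
  · refine le_trans ?_ (ht _)
    push_cast
    have : 0 ≤ τ * M := by positivity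
    linarith

lemma walk_add_period {T : ℕ → G} {P : ℕ} (hT : ∀ i, T (i + P) = T i) (q r : ℕ) :
    walk T (P * q + r) = walk T P ^ q * walk T r := by
  have step : ∀ i, walk T (i + P) = walk T P * walk T i := by
    intro i
    induction i with
    | zero => simp [walk]
    | succ i ih => rw [Nat.add_right_comm, walk, ih, hT, walk, mul_assoc]
  induction q with
  | zero => simp
  | succ q ih => rw [Nat.mul_succ, Nat.add_right_comm, step, ih, pow_succ', mul_assoc]

/-- An element whose powers span a chain, one of whose links has finite joint coarse stabilizer,
is WPD. -/
lemma isWPD_walk_of_isChain {δ : ℝ} (hδ : FourPoint X δ) {o : X} {T : ℕ → G} {c : ℕ → ℝ} {P : ℕ}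
    (hP : 0 < P) (hT : ∀ i, T (i + P) = T i) (hc : ∀ i, c (i + P) = c i)
    (hchain : IsChain δ (fun i => walk T i • o) c) {r : ℕ} {C : ℝ} (hr : c r = C)
    (hr' : c (r + 1) = C)
    (hfin : (jointCoarseStab G (2 * (C + 2 * δ + 2 * δ) + 2 * δ + 1) o (T r • o)).Finite) :
    IsWPD X (walk T P) := by
  have hδ0 := hδ.nonneg o
  have hcP : ∀ q i, c (P * q + i) = c i := by
    intro q i
    induction q with
    | zero => simp
    | succ q ih => rw [Nat.mul_succ, Nat.add_right_comm, hc, ih]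
  have hTP : ∀ q i, T (P * q + i) = T i := by
    intro q i
    induction q with
    | zero => simp
    | succ q ih => rw [Nat.mul_succ, Nat.add_right_comm, hT, ih]
  have w0 : walk T 0 • o = o := one_smul G o
  have hc0 := hchain.nonneg 0
  have hC0 := hchain.nonneg r
  rw [hr] at hC0
  have hpow : ∀ q, walk T (P * q) = walk T P ^ q := fun q => by
    simpa [walk] using walk_add_period hT q 0
  have hle : ∀ i k, i ≤ k → c k - c i + (k - i : ℝ) ≤ dist (walk T i • o) (walk T k • o) := by
    intro i k hik
    have := hchain.le_dist_add hδ i (k - i)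
    rwa [Nat.add_sub_cancel' hik, Nat.cast_sub hik] at this
  have hPj : ∀ j : ℕ, (j : ℝ) ≤ (P * j : ℕ) := fun j => by
    exact_mod_cast Nat.le_mul_of_pos_left j hP
  refine ⟨isLoxodromic_of_linear_growth (o := o) (κ := 1) (C := 0) one_pos fun n => ?_, ?_⟩
  · have h₁ := hle 0 (P * n) (Nat.zero_le _)
    have h₂ := hcP n 0
    have h₃ := hPj n
    rw [add_zero] at h₂
    rw [hpow, walk, one_smul, h₂, Nat.cast_zero] at h₁
    linarith
  intro K hK x
  set K' := K + 2 * dist x o with hK'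
  have hK'0 : 0 ≤ K' := by positivity
  -- The link of index $Pj+r$ sits in the middle of the $2j$ periods from $0$ to $2Pj$; $j$ is large
  -- enough for both ends of this link to be far from both endpoints.
  obtain ⟨j, hj⟩ := exists_nat_gt (K' + C + 4 * δ + C + c 0 + r + 2)
  have hj0 : r + 1 < j := by
    have : ((r + 1 : ℕ) : ℝ) < j := by push_cast; linarith
    exact_mod_cast this
  have hjP : j ≤ P * j := Nat.le_mul_of_pos_left j hP
  have hjPr := hPj j
  have hend : P * (2 * j) = P * j + P * j := by ring
  refine ⟨2 * j, by omega, ?_⟩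
  have main : (jointCoarseStab G K' o (walk T P ^ (2 * j) • o)).Finite := by
    have hfin' := jointCoarseStab_smul_finite hfin (walk T (P * j + r))
    rw [← hTP j r, ← mul_smul] at hfin'
    change (jointCoarseStab G _ _ (walk T (P * j + r + 1) • o)).Finite at hfin'
    rw [← hpow]
    have g₁ := hchain.gp_le_of_lt hδ (i := 0) (j := P * j + r) (k := P * (2 * j))
      (by omega) (by omega)
    have g₂ := hchain.gp_le_of_lt hδ (i := 0) (j := P * j + r + 1) (k := P * (2 * j))
      (by omega) (by omega)
    have d₁ := hle 0 (P * j + r) (by omega)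
    have d₂ := hle 0 (P * j + r + 1) (by omega)
    have d₃ := hle (P * j + r) (P * (2 * j)) (by omega)
    have d₄ := hle (P * j + r + 1) (P * (2 * j)) (by omega)
    have c₁ : c (P * (2 * j)) = c 0 := by simpa using hcP (2 * j) 0
    rw [hend] at d₃ d₄ c₁
    rw [c₁] at d₃ d₄
    rw [add_assoc (P * j)] at g₂ d₂ d₄ hfin'
    rw [hcP, hr'] at g₂ d₂ d₄
    rw [hcP, hr] at g₁ d₁ d₃
    rw [hend] at g₁ g₂ ⊢
    rw [w0] at d₁ d₂
    simp only [w0] at g₁ g₂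
    push_cast at d₁ d₂ d₃ d₄ hjPr
    refine jointCoarseStab_finite_of_far hδ hfin' g₁ g₂ ?_ ?_ ?_ ?_
    · rw [dist_comm]; linarith
    · linarith
    · rw [dist_comm]; linarith
    · linarith
  refine main.subset fun f hf => ?_
  have move : ∀ g : G, dist (g • x) (f • g • x) ≤ K → dist (g • o) (f • g • o) ≤ K' := by
    intro g hg
    have := dist_triangle4 (g • o) (g • x) (f • g • x) (f • g • o)
    rw [dist_smul, dist_smul, dist_smul, dist_comm o x] at this
    linarith
  refine ⟨by simpa using move 1 (by simpa using hf.1), move _ hf.2⟩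

/-- A product of six elements which is cyclically aligned, with a middle part of finite joint
coarse stabilizer, is WPD. -/
lemma isWPD_of_aligned {δ : ℝ} (hδ : FourPoint X δ) {o : X} {u s h s' v z : G} {C r : ℝ}
    (hC : 0 ≤ C) (hr : 0 ≤ r)
    (h₀ : gp o (z⁻¹ • o) (u • o) ≤ r) (h₁ : gp o (u⁻¹ • o) (s • o) ≤ C)
    (h₂ : gp o (s⁻¹ • o) (h • o) ≤ C) (h₃ : gp o (h⁻¹ • o) (s' • o) ≤ C)
    (h₄ : gp o (s'⁻¹ • o) (v • o) ≤ C) (h₅ : gp o (v⁻¹ • o) (z • o) ≤ r)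
    (hu : r + C + 3 * δ + 1 ≤ dist o (u • o)) (hs : 2 * C + 3 * δ + 1 ≤ dist o (s • o))
    (hh : 2 * C + 3 * δ + 1 ≤ dist o (h • o)) (hs' : 2 * C + 3 * δ + 1 ≤ dist o (s' • o))
    (hv : r + C + 3 * δ + 1 ≤ dist o (v • o)) (hz : 2 * r + 3 * δ + 1 ≤ dist o (z • o))
    (hfin : (jointCoarseStab G (2 * (C + 2 * δ + 2 * δ) + 2 * δ + 1) o (h • o)).Finite) :
    IsWPD X (u * s * h * s' * v * z) := by
  -- The entry of `b` at an index bounds the Gromov product at the junction before the corresponding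
  -- letter of `t`; only the junctions $z|u$ and $v|z$ have the weaker bound $r$.
  let t : Fin 6 → G := ![u, s, h, s', v, z]
  let b : Fin 6 → ℝ := ![r, C, C, C, C, r]
  have hsucc : ∀ i : ℕ, Fin.ofNat 6 (i + 1) = Fin.ofNat 6 i + 1 := fun i => by
    ext; simp [Fin.val_add]
  have hper : ∀ i : ℕ, Fin.ofNat 6 (i + 6) = Fin.ofNat 6 i := fun i => by
    ext; simp
  have e : walk (fun i => t (Fin.ofNat 6 i)) 6 = u * s * h * s' * v * z := by
    simp only [walk, one_mul]; rfl
  rw [← e]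
  refine isWPD_walk_of_isChain hδ (o := o) (c := fun i => b (Fin.ofNat 6 i)) (by norm_num)
    (fun i => by rw [hper]) (fun i => by rw [hper]) ?_ (r := 2) (C := C) rfl rfl hfin
  have k₀ : ∀ k, 0 ≤ b k := by intro k; fin_cases k <;> assumption
  have k₁ : ∀ k, gp o ((t k)⁻¹ • o) (t (k + 1) • o) ≤ b (k + 1) := by
    intro k; fin_cases k <;> assumption
  have k₂ : ∀ k, b k + b (k + 1) + 3 * δ + 1 ≤ dist o (t k • o) := by
    intro k
    fin_cases k
    · exact hu
    · change C + C + 3 * δ + 1 ≤ dist o (s • o); linarith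
    · change C + C + 3 * δ + 1 ≤ dist o (h • o); linarith
    · change C + C + 3 * δ + 1 ≤ dist o (s' • o); linarith
    · change C + r + 3 * δ + 1 ≤ dist o (v • o); linarith
    · change r + r + 3 * δ + 1 ≤ dist o (z • o); linarith
  refine isChain_walk (fun i => k₀ _) (fun i => ?_) (fun i => ?_)
  · simp only [hsucc]; exact k₁ _
  · simp only [hsucc]; exact k₂ _

end Criterion

/-! ### Expectations over finitely many independent steps, without measurability. -/

section StepExp

variable {G : Type*}

/-- The expectation of a function of `n` independent steps with weights `p`. -/
def stepExp (p : G → ℝ≥0∞) : ℕ → (List G → ℝ≥0∞) → ℝ≥0∞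
  | 0, F => F []
  | n + 1, F => ∑' g, p g * stepExp p n fun l => F (g :: l)

/-- The probability of a set of sequences of `n` independent steps with weights `p`. -/
def stepProb (p : G → ℝ≥0∞) (n : ℕ) (A : Set (List G)) : ℝ≥0∞ := stepExp p n (A.indicator 1)

variable {p : G → ℝ≥0∞}

/-- Restricting the comparison to lists of letters of positive weight is what lets the boundedness
of the support be used. -/
lemma stepExp_mono {n : ℕ} {F F' : List G → ℝ≥0∞}
    (h : ∀ l : List G, l.length = n → (∀ g ∈ l, p g ≠ 0) → F l ≤ F' l) :
    stepExp p n F ≤ stepExp p n F' := by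
  induction n generalizing F F' with
  | zero => exact h [] rfl (by simp)
  | succ n ih =>
    refine ENNReal.tsum_le_tsum fun g => ?_
    by_cases hg : p g = 0
    · simp [hg]
    gcongr
    refine ih fun l hl hl' => h _ (by simp [hl]) ?_
    simpa using ⟨hg, hl'⟩

lemma stepExp_congr {n : ℕ} {F F' : List G → ℝ≥0∞}
    (h : ∀ l : List G, l.length = n → F l = F' l) : stepExp p n F = stepExp p n F' :=
  le_antisymm (stepExp_mono fun l hl _ => (h l hl).le) (stepExp_mono fun l hl _ => (h l hl).ge)

lemma stepExp_tsum {ι : Type*} (n : ℕ) (c : ι → ℝ≥0∞) (F : ι → List G → ℝ≥0∞) :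
    stepExp p n (fun l => ∑' i, c i * F i l) = ∑' i, c i * stepExp p n (F i) := by
  induction n generalizing F with
  | zero => rfl
  | succ n ih =>
    simp only [stepExp, ih, ← ENNReal.tsum_mul_left]
    rw [ENNReal.tsum_comm]
    refine tsum_congr fun i => tsum_congr fun g => ?_
    ring

lemma stepExp_add (n : ℕ) (F F' : List G → ℝ≥0∞) :
    stepExp p n (fun l => F l + F' l) = stepExp p n F + stepExp p n F' := by
  induction n generalizing F F' with
  | zero => rfl
  | succ n ih => simp only [stepExp, ih, mul_add, ENNReal.tsum_add]

lemma stepExp_const_mul (n : ℕ) (c : ℝ≥0∞) (F : List G → ℝ≥0∞) :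
    stepExp p n (fun l => c * F l) = c * stepExp p n F := by
  induction n generalizing F with
  | zero => rfl
  | succ n ih =>
    simp only [stepExp, ih, ← ENNReal.tsum_mul_left]
    exact tsum_congr fun g => by ring

lemma stepExp_sum {ι : Type*} (n : ℕ) (s : Finset ι) (F : ι → List G → ℝ≥0∞) :
    stepExp p n (fun l => ∑ i ∈ s, F i l) = ∑ i ∈ s, stepExp p n (F i) := by
  classical
  induction s using Finset.induction_on with
  | empty => simpa using stepExp_const_mul (p := p) n 0 fun _ => 0
  | insert i s hi ih => simp only [Finset.sum_insert hi, stepExp_add, ih]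

lemma stepExp_const (hp : ∑' g, p g = 1) (n : ℕ) (c : ℝ≥0∞) :
    stepExp p n (fun _ => c) = c := by
  induction n with
  | zero => rfl
  | succ n ih => simp only [stepExp, ih, ENNReal.tsum_mul_right, hp, one_mul]

lemma stepExp_append (m n : ℕ) (F : List G → ℝ≥0∞) :
    stepExp p (m + n) F = stepExp p m fun l => stepExp p n fun l' => F (l ++ l') := by
  induction m generalizing F with
  | zero => simp [stepExp]
  | succ m ih =>
    rw [Nat.succ_add]
    simp only [stepExp, ih, List.cons_append]

lemma stepExp_comm (m n : ℕ) (F : List G → List G → ℝ≥0∞) :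
    stepExp p m (fun l => stepExp p n (F l)) =
      stepExp p n fun l' => stepExp p m fun l => F l l' := by
  induction m generalizing F with
  | zero => rfl
  | succ m ih => simp only [stepExp, ih, stepExp_tsum]

lemma stepProb_mono {n : ℕ} {A B : Set (List G)}
    (h : ∀ l : List G, l.length = n → (∀ g ∈ l, p g ≠ 0) → l ∈ A → l ∈ B) :
    stepProb p n A ≤ stepProb p n B := by
  refine stepExp_mono fun l hl hl' => ?_
  by_cases hA : l ∈ A
  · simp [hA, h l hl hl' hA]
  · simp [hA]

lemma stepProb_le_one (hp : ∑' g, p g = 1) (n : ℕ) (A : Set (List G)) : stepProb p n A ≤ 1 := by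
  refine (stepExp_mono fun l _ _ => Set.indicator_le_self' (by simp) l).trans ?_
  exact (stepExp_const hp n 1).le

lemma stepProb_empty (n : ℕ) : stepProb p n (∅ : Set (List G)) = 0 := by
  simpa [stepProb] using stepExp_const_mul (p := p) n 0 fun _ => 0

lemma stepProb_union_le (n : ℕ) (A B : Set (List G)) :
    stepProb p n (A ∪ B) ≤ stepProb p n A + stepProb p n B := by
  rw [stepProb, stepProb, stepProb, ← stepExp_add]
  refine stepExp_mono fun l _ _ => ?_
  by_cases hA : l ∈ A <;> by_cases hB : l ∈ B <;> simp [hA, hB]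

lemma stepProb_or_le (n : ℕ) (P Q : List G → Prop) :
    stepProb p n {l | P l ∨ Q l} ≤ stepProb p n {l | P l} + stepProb p n {l | Q l} :=
  le_trans (stepProb_mono fun _ _ _ h => h) (stepProb_union_le n {l | P l} {l | Q l})

lemma stepProb_iUnion_le (n L : ℕ) (A : ℕ → Set (List G)) :
    stepProb p n {l | ∃ i < L, l ∈ A i} ≤ ∑ i ∈ Finset.range L, stepProb p n (A i) := by
  simp only [stepProb]
  rw [← stepExp_sum]
  refine stepExp_mono fun l _ _ => ?_
  by_cases h : ∃ i < L, l ∈ A i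
  · obtain ⟨i, hi, hl⟩ := h
    calc Set.indicator {l | ∃ i < L, l ∈ A i} 1 l ≤ (A i).indicator 1 l := by
          simp only [Set.indicator_of_mem hl]
          exact Set.indicator_le_self' (by simp) l
      _ ≤ _ := Finset.single_le_sum (f := fun i => (A i).indicator (1 : List G → ℝ≥0∞) l)
          (fun _ _ => bot_le) (Finset.mem_range.2 hi)
  · have : l ∉ {l | ∃ i < L, l ∈ A i} := h
    rw [Set.indicator_of_notMem this]
    exact bot_le

lemma stepProb_add_compl (hp : ∑' g, p g = 1) (n : ℕ) (A : Set (List G)) :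
    stepProb p n A + stepProb p n Aᶜ = 1 := by
  rw [stepProb, stepProb, ← stepExp_add, ← stepExp_const hp n 1]
  refine stepExp_congr fun l _ => ?_
  by_cases hA : l ∈ A <;> simp [hA]

/-- Markov's inequality. -/
lemma mul_stepProb_le (n : ℕ) (a : ℝ≥0∞) (F : List G → ℝ≥0∞) :
    a * stepProb p n {l | a ≤ F l} ≤ stepExp p n F := by
  rw [stepProb, ← stepExp_const_mul]
  refine stepExp_mono fun l _ _ => ?_
  by_cases h : l ∈ {l | a ≤ F l}
  · rw [Set.indicator_of_mem h]; simpa using h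
  · rw [Set.indicator_of_notMem h]; simp

/-- Splitting off the first `m` steps. -/
lemma stepProb_append (m n : ℕ) (A : Set (List G)) :
    stepProb p (m + n) A = stepExp p m fun l => stepProb p n {l' | l ++ l' ∈ A} :=
  stepExp_append m n _

lemma stepExp_le_of_le (hp : ∑' g, p g = 1) {n : ℕ} {F : List G → ℝ≥0∞} {c : ℝ≥0∞}
    (h : ∀ l : List G, l.length = n → (∀ g ∈ l, p g ≠ 0) → F l ≤ c) : stepExp p n F ≤ c :=
  (stepExp_mono h).trans (stepExp_const hp n c).le

lemma stepProb_take (hp : ∑' g, p g = 1) {j n : ℕ} (hj : j ≤ n) (B : Set (List G)) :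
    stepProb p n {l | l.take j ∈ B} = stepProb p j B := by
  obtain ⟨m, rfl⟩ := Nat.exists_eq_add_of_le hj
  rw [stepProb_append, stepProb]
  refine stepExp_congr fun l hl => ?_
  have : ∀ l' : List G, (l ++ l').take j = l := fun l' => by
    rw [← hl]; simp
  by_cases hB : l ∈ B
  · have e : {l' : List G | l ++ l' ∈ {l | l.take j ∈ B}} = Set.univ :=
      Set.eq_univ_of_forall fun l' => by change (l ++ l').take j ∈ B; rwa [this]
    rw [e, Set.indicator_of_mem hB, stepProb, Set.indicator_univ]
    exact stepExp_const hp m 1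
  · have e : {l' : List G | l ++ l' ∈ {l | l.take j ∈ B}} = ∅ :=
      Set.eq_empty_of_forall_notMem fun l' h => hB (by
        change (l ++ l').take j ∈ B at h; rwa [this] at h)
    rw [e, Set.indicator_of_notMem hB, stepProb_empty]

end StepExp

/-! ### The law of the position of the walk. -/

section Products

variable {G : Type*} [Group G] {p : G → ℝ≥0∞}

/-- The weight of `g` in the law of the product of `n` independent steps. -/
def prodMass (p : G → ℝ≥0∞) (n : ℕ) (g : G) : ℝ≥0∞ := stepProb p n {l | l.prod = g}

lemma stepExp_prod (n : ℕ) (f : G → ℝ≥0∞) :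
    stepExp p n (fun l => f l.prod) = ∑' g, prodMass p n g * f g := by
  classical
  have e : ∀ l : List G, f l.prod = ∑' g, f g * Set.indicator {l : List G | l.prod = g} 1 l := by
    intro l
    rw [tsum_eq_single l.prod]
    · simp
    · intro g hg
      have : l ∉ {l : List G | l.prod = g} := fun h => hg h.symm
      simp [Set.indicator_of_notMem this]
  simp only [e]
  rw [stepExp_tsum]
  refine tsum_congr fun g => ?_
  rw [mul_comm]; rfl

lemma prodMass_mul_le (m n : ℕ) (g h : G) :
    prodMass p m g * prodMass p n h ≤ prodMass p (m + n) (g * h) := by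
  rw [prodMass, prodMass, prodMass, stepProb_append, mul_comm]
  change stepProb p n _ * stepExp p m _ ≤ _
  rw [← stepExp_const_mul]
  refine stepExp_mono fun l _ _ => ?_
  by_cases hl : l ∈ {l : List G | l.prod = g}
  · simp only [Set.indicator_of_mem hl, Pi.one_apply, mul_one]
    refine stepProb_mono fun l' _ _ hl' => ?_
    have h₁ : l.prod = g := hl
    have h₂ : l'.prod = h := hl'
    change (l ++ l').prod = g * h
    rw [List.prod_append, h₁, h₂]
  · simp [Set.indicator_of_notMem hl]

lemma prodMass_pow_pos {n : ℕ} {g : G} (h : 0 < prodMass p n g) (k : ℕ) :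
    0 < prodMass p (n * k) (g ^ k) := by
  induction k with
  | zero =>
    have : ([] : List G) ∈ {l : List G | l.prod = g ^ 0} := by simp
    rw [Nat.mul_zero, prodMass, stepProb, stepExp, Set.indicator_of_mem this]
    simp
  | succ k ih =>
    rw [Nat.mul_succ, pow_succ]
    exact (ENNReal.mul_pos ih.ne' h.ne').trans_le (prodMass_mul_le _ _ _ _)

lemma prodMass_mul_pos {m n : ℕ} {g h : G} (hg : 0 < prodMass p m g) (hh : 0 < prodMass p n h) :
    0 < prodMass p (m + n) (g * h) :=
  (ENNReal.mul_pos hg.ne' hh.ne').trans_le (prodMass_mul_le _ _ _ _)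

lemma prodMass_one (g : G) : prodMass p 1 g = p g := by
  classical
  simp only [prodMass, stepProb, stepExp]
  rw [tsum_eq_single g]
  · simp
  · intro h hh
    simp [hh]

lemma exists_prodMass_pos {g : G} (hg : g ∈ Subsemigroup.closure {g | p g ≠ 0}) :
    ∃ n, 0 < prodMass p n g := by
  induction hg using Subsemigroup.closure_induction with
  | mem g hg => exact ⟨1, by rw [prodMass_one]; exact pos_iff_ne_zero.2 hg⟩
  | mul g h _ _ ihg ihh =>
    obtain ⟨m, hm⟩ := ihg
    obtain ⟨n, hn⟩ := ihh
    exact ⟨m + n, prodMass_mul_pos hm hn⟩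

lemma exists_list_of_prodMass_ne_zero {n : ℕ} {g : G} (h : prodMass p n g ≠ 0) :
    ∃ l : List G, l.length = n ∧ (∀ a ∈ l, p a ≠ 0) ∧ l.prod = g := by
  by_contra! hcon
  refine h (le_antisymm ?_ bot_le)
  refine (stepProb_mono (B := ∅) fun l h₁ h₂ h₃ => (hcon l h₁ h₂ h₃).elim).trans ?_
  exact (stepProb_empty n).le

lemma dist_list_prod_smul_le {X : Type*} [MetricSpace X] [MulAction G X] [IsIsometricSMul G X]
    {o : X} {R : ℝ} (l : List G) (hl : ∀ g ∈ l, dist o (g • o) ≤ R) :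
    dist o (l.prod • o) ≤ l.length * R := by
  induction l with
  | nil => simp
  | cons g l ih =>
    have h₁ := dist_mul_smul_le o g l.prod
    have h₂ := hl g (by simp)
    have h₃ := ih fun a ha => hl a (by simp [ha])
    rw [List.prod_cons, List.length_cons]
    push_cast
    linarith

end Products

/-! ### Positive drift away from every point. -/

section Drift

variable {G : Type*} [Group G] {X : Type*} [MetricSpace X] [MulAction G X] [IsIsometricSMul G X]
  {p : G → ℝ≥0∞}

/-- The law of a product of `k` steps dominates a multiple of the counting measure of a finite
family of elements of positive weight. -/
lemma exists_stepExp_prod_decomposition (hp : ∑' g, p g = 1) {k : ℕ} {s : Fin 12 → G}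
    (hs : ∀ i, 0 < prodMass p k (s i)) :
    ∃ (β : ℝ≥0∞) (r : G → ℝ≥0∞), β ≠ 0 ∧ β ≠ ∞ ∧ 12 * β + ∑' g, r g = 1 ∧
      (∀ g, r g ≠ 0 → prodMass p k g ≠ 0) ∧
      ∀ f : G → ℝ≥0∞, stepExp p k (fun l => f l.prod) =
        β * ∑ i, f (s i) + ∑' g, r g * f g := by
  classical
  obtain ⟨i₀, -, hi₀⟩ := Finset.exists_min_image Finset.univ (fun i => prodMass p k (s i))
    ⟨0, Finset.mem_univ _⟩
  -- Dividing by 12 keeps the sum of the point masses below the law even if some of the $s_i$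
  -- coincide.
  set β := prodMass p k (s i₀) / 12 with hβ
  have hle1 : prodMass p k (s i₀) ≤ 1 := stepProb_le_one hp _ _
  have hβ0 : β ≠ 0 := (ENNReal.div_pos (hs i₀).ne' (by simp)).ne'
  have hβt : β ≠ ∞ := ENNReal.div_ne_top (ne_top_of_le_ne_top ENNReal.one_ne_top hle1) (by simp)
  let c : G → ℝ≥0∞ := fun g => ∑ i, if s i = g then β else 0
  have hc : ∀ g, c g ≤ prodMass p k g := by
    intro g
    by_cases hg : ∃ i, s i = g
    · obtain ⟨j, rfl⟩ := hg
      calc c (s j) ≤ ∑ _i : Fin 12, β := Finset.sum_le_sum fun i _ => by split_ifs <;> simp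
        _ = 12 * β := by simp
        _ = prodMass p k (s i₀) := ENNReal.mul_div_cancel (by simp) (by simp)
        _ ≤ _ := hi₀ j (Finset.mem_univ j)
    · push Not at hg
      simp [c, hg]
  have hdec : ∀ f : G → ℝ≥0∞, stepExp p k (fun l => f l.prod) =
      β * ∑ i, f (s i) + ∑' g, (prodMass p k g - c g) * f g := by
    intro f
    have e : β * ∑ i, f (s i) = ∑' g, c g * f g := by
      simp only [c, Finset.sum_mul]
      rw [Summable.tsum_finsetSum fun _ _ => ENNReal.summable, Finset.mul_sum]
      refine Finset.sum_congr rfl fun i _ => ?_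
      rw [tsum_eq_single (s i)]
      · simp
      · intro g hg; simp [hg.symm]
    rw [stepExp_prod, e, ← ENNReal.tsum_add]
    refine tsum_congr fun g => ?_
    rw [← add_mul, add_tsub_cancel_of_le (hc g)]
  refine ⟨β, fun g => prodMass p k g - c g, hβ0, hβt, ?_, ?_, hdec⟩
  · have := hdec fun _ => 1
    rw [stepExp_const hp] at this
    simp only [mul_one, Finset.sum_const, Finset.card_univ, Fintype.card_fin] at this
    rw [this]
    simp [mul_comm]
  · intro g hg h0
    exact hg (by simp [h0])

lemma edist_inv_smul (g : G) (x y : X) : edist (g⁻¹ • x) y = edist x (g • y) := by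
  rw [← edist_smul_left g (g⁻¹ • x), smul_inv_smul]

/-- The expected distance to any point increases, by a definite amount. -/
lemma exists_drift {δ C D R : ℝ} (hδ : FourPoint X δ) {o : X} (hp : ∑' g, p g = 1)
    (hR : ∀ g, p g ≠ 0 → dist o (g • o) ≤ R) {k : ℕ} {s : Fin 12 → G}
    (hsp : ∀ i, 0 < prodMass p k (s i)) (hs : IsSchottky o C D s) (hC : 0 ≤ C)
    (hD : 40 * C + 40 * δ + 40 ≤ D) :
    ∃ n : ℕ, 0 < n ∧ ∀ y : X, edist y o + 1 ≤ stepExp p n fun l => edist y (l.prod • o) := by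
  obtain ⟨β, r, hβ0, hβt, htot, hr, hdec⟩ := exists_stepExp_prod_decomposition hp hsp
  have split : ∀ (N : ℕ) (f : G → ℝ≥0∞), stepExp p (k * (N + 1)) (fun l => f l.prod) =
      β * ∑ i, stepExp p (k * N) (fun l => f (s i * l.prod)) +
        ∑' g, r g * stepExp p (k * N) (fun l => f (g * l.prod)) := by
    intro N f
    rw [Nat.mul_succ, add_comm, stepExp_append]
    simp only [List.prod_append]
    exact hdec fun g => stepExp p (k * N) fun l => f (g * l.prod)
  have avg : ∀ y x : X, 12 * (edist y o + 1) ≤ ∑ i, edist y (s i • x) := by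
    intro y x
    have h := hs.sum_dist_ge hδ hC hD y x
    have h' := ENNReal.ofReal_le_ofReal h
    rw [ENNReal.ofReal_sum_of_nonneg fun _ _ => dist_nonneg, ENNReal.ofReal_mul (by norm_num),
      ENNReal.ofReal_add dist_nonneg (by norm_num)] at h'
    simpa only [edist_dist, ENNReal.ofReal_one, ENNReal.ofReal_ofNat] using h'
  -- Once a uniform Schottky element has been inserted, each further block gains $12\beta$ on
  -- average. A block that is itself Schottky, which has total weight $12\beta$, closes the current
  -- stage and gains 1; any other block is absorbed into `t`, because the averaging inequality holds
  -- whatever follows the inserted element.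
  have afterS : ∀ (N : ℕ) (y : X) (t : G), 12 * (edist y o + (1 + 12 * β * N)) ≤
      ∑ i, stepExp p (k * N) fun l => edist y ((s i * t * l.prod) • o) := by
    intro N
    induction N with
    | zero =>
      intro y t
      simp only [Nat.cast_zero, mul_zero, add_zero, stepExp, List.prod_nil, mul_one]
      simpa only [mul_smul] using avg y (t • o)
    | succ N ih =>
      intro y t
      have e : ∀ i, stepExp p (k * (N + 1)) (fun l => edist y ((s i * t * l.prod) • o)) =
          β * ∑ j, stepExp p (k * N) (fun l => edist y ((s i * t * (s j * l.prod)) • o)) +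
          ∑' g, r g * stepExp p (k * N) (fun l => edist y ((s i * t * (g * l.prod)) • o)) :=
        fun i => split N fun g => edist y ((s i * t * g) • o)
      simp only [e, Finset.sum_add_distrib, ← Finset.mul_sum]
      rw [← Summable.tsum_finsetSum fun _ _ => ENNReal.summable]
      simp only [← Finset.mul_sum]
      set b := 1 + 12 * β * N with hb
      have h₁ : 12 * (12 * (edist y o + 1)) + 12 * (12 * b) ≤ ∑ i, ∑ j, stepExp p (k * N)
          (fun l => edist y ((s i * t * (s j * l.prod)) • o)) := by
        calc 12 * (12 * (edist y o + 1)) + 12 * (12 * b)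
            ≤ 12 * (∑ i, edist y ((s i * t) • o)) + 12 * (12 * b) := by
              gcongr
              simpa only [mul_smul] using avg y (t • o)
          _ = ∑ i, 12 * (edist y ((s i * t) • o) + b) := by
              simp only [mul_add, Finset.sum_add_distrib, ← Finset.mul_sum]
              simp
          _ ≤ _ := by
              refine Finset.sum_le_sum fun i _ => ?_
              have := ih ((s i * t)⁻¹ • y) 1
              simpa only [edist_inv_smul, mul_one, ← mul_smul, mul_assoc] using this
      have h₂ : (∑' g, r g) * (12 * (edist y o + b)) ≤ ∑' g, r g * ∑ i, stepExp p (k * N)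
          (fun l => edist y ((s i * t * (g * l.prod)) • o)) := by
        rw [← ENNReal.tsum_mul_right]
        refine ENNReal.tsum_le_tsum fun g => ?_
        gcongr
        simpa only [mul_assoc] using ih y (t * g)
      calc 12 * (edist y o + (1 + 12 * β * (N + 1 : ℕ)))
          = 12 * (edist y o + b) * (12 * β + ∑' g, r g) + 144 * β := by
            rw [htot, hb]; push_cast; ring
        _ = β * (12 * (12 * (edist y o + 1)) + 12 * (12 * b)) +
              (∑' g, r g) * (12 * (edist y o + b)) := by ring
        _ ≤ _ := by gcongr
  -- Before the first Schottky block each block loses at most $kR$; the waiting time is geometric of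
  -- parameter $12\beta$, so the expected loss is at most $kR/(12\beta)$.
  set c₀ : ℝ≥0∞ := ENNReal.ofReal (k * R) / (12 * β) with hc₀
  have h12 : 12 * β ≠ 0 := mul_ne_zero (by simp) hβ0
  have h12' : 12 * β ≠ ∞ := ENNReal.mul_ne_top (by simp) hβt
  have hc₀t : c₀ ≠ ∞ := ENNReal.div_ne_top ENNReal.ofReal_ne_top h12
  have hr1 : ∑' g, r g ≤ 1 := by rw [← htot]; exact le_add_self
  have hmul : (∑' g, r g) * ENNReal.ofReal (k * R) ≤ 12 * β * c₀ := by
    rw [hc₀, ENNReal.mul_div_cancel h12 h12']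
    exact mul_le_of_le_one_left bot_le hr1
  have free : ∀ (N : ℕ) (y : X), edist y o + 12 * β * N ≤
      stepExp p (k * N) (fun l => edist y (l.prod • o)) + c₀ := by
    intro N
    induction N with
    | zero => intro y; simp [stepExp]
    | succ N ih =>
      intro y
      have h₁ : 12 * (edist y o + (1 + 12 * β * N)) ≤
          ∑ i, stepExp p (k * N) fun l => edist y ((s i * l.prod) • o) := by
        simpa only [mul_one] using afterS N y 1
      have h₂ : (∑' g, r g) * (edist y o + 12 * β * N) ≤
          (∑' g, r g * stepExp p (k * N) (fun l => edist y ((g * l.prod) • o))) +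
            (∑' g, r g) * ENNReal.ofReal (k * R) + (∑' g, r g) * c₀ := by
        rw [← ENNReal.tsum_mul_right, ← ENNReal.tsum_mul_right, ← ENNReal.tsum_mul_right,
          ← ENNReal.tsum_add, ← ENNReal.tsum_add]
        refine ENNReal.tsum_le_tsum fun g => ?_
        by_cases hg : r g = 0
        · simp [hg]
        rw [← mul_add, ← mul_add]
        gcongr r g * ?_
        obtain ⟨l, hl₁, hl₂, rfl⟩ := exists_list_of_prodMass_ne_zero (hr g hg)
        have h₃ := dist_list_prod_smul_le l fun a ha => hR a (hl₂ a ha)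
        rw [hl₁] at h₃
        have h₄ := ih (l.prod⁻¹ • y)
        simp only [edist_inv_smul, ← mul_smul] at h₄
        have h₅ : edist y o ≤ edist y (l.prod • o) + ENNReal.ofReal (k * R) := by
          refine (edist_triangle y (l.prod • o) o).trans ?_
          gcongr
          rw [edist_comm, edist_dist]
          exact ENNReal.ofReal_le_ofReal h₃
        calc edist y o + 12 * β * N
            ≤ edist y (l.prod • o) + ENNReal.ofReal (k * R) + 12 * β * N := by gcongr
          _ = edist y (l.prod • o) + 12 * β * N + ENNReal.ofReal (k * R) := by ring
          _ ≤ _ := by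
            refine (add_le_add_left h₄ _).trans (le_of_eq ?_)
            ring
      rw [split N fun g => edist y (g • o)]
      calc edist y o + 12 * β * (N + 1 : ℕ)
          = β * (12 * (edist y o + (1 + 12 * β * N))) +
              (∑' g, r g) * (edist y o + 12 * β * N) := by
            have : edist y o + 12 * β * (N + 1 : ℕ) =
              (edist y o + 12 * β * N) * (12 * β + ∑' g, r g) + 12 * β := by
              rw [htot]; push_cast; ring
            rw [this]; ring
        _ ≤ β * (∑ i, stepExp p (k * N) fun l => edist y ((s i * l.prod) • o)) +
            ((∑' g, r g * stepExp p (k * N) (fun l => edist y ((g * l.prod) • o))) +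
              12 * β * c₀ + (∑' g, r g) * c₀) := by
            gcongr
            exact h₂.trans (by gcongr)
        _ = β * (∑ i, stepExp p (k * N) fun l => edist y ((s i * l.prod) • o)) +
            (∑' g, r g * stepExp p (k * N) (fun l => edist y ((g * l.prod) • o))) +
              (12 * β + ∑' g, r g) * c₀ := by ring
        _ = _ := by rw [htot, one_mul]
  obtain ⟨N, hN⟩ := ENNReal.exists_nat_mul_gt h12 (b := c₀ + 1) (by simp [hc₀t])
  have hmain : ∀ y : X, edist y o + 1 ≤ stepExp p (k * N) fun l => edist y (l.prod • o) := by
    intro y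
    have h := free N y
    refine (ENNReal.add_le_add_iff_right hc₀t).1 (le_trans ?_ h)
    rw [add_assoc]
    gcongr
    rw [add_comm, mul_comm (12 * β)]
    exact hN.le
  refine ⟨k * N, Nat.pos_of_ne_zero fun h0 => ?_, hmain⟩
  have := hmain o
  rw [h0] at this
  simp [stepExp] at this

end Drift

/-! ### Exponential decay, and deviation estimates for lengths and directions. -/

section Contraction

variable {G : Type*} [Group G] {X : Type*} [MetricSpace X] [MulAction G X] {p : G → ℝ≥0∞}

/-- Exponential decay of the walk away from any point. -/
def HasExpDecay (p : G → ℝ≥0∞) (o : X) (ε A lam : ℝ) : Prop :=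
  ∀ (n : ℕ) (y : X),
    stepExp p n (fun l => ENNReal.ofReal (Real.exp (-ε * dist y (l.prod • o)))) ≤
      ENNReal.ofReal (A * lam ^ n * Real.exp (-ε * dist y o))

/-- Markov's inequality. With $y=o$ it says that the walk is rarely short; with $n$ discarded, that
a remote ball is rarely visited at a given time. -/
lemma HasExpDecay.stepProb_dist_le {o : X} {ε A lam : ℝ} (hε : 0 < ε)
    (h : HasExpDecay p o ε A lam) (n : ℕ) (y : X) (r : ℝ) :
    stepProb p n {l | dist y (l.prod • o) ≤ r} ≤
      ENNReal.ofReal (A * lam ^ n * Real.exp (-ε * (dist y o - r))) := by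
  have h₁ := mul_stepProb_le (p := p) n (ENNReal.ofReal (Real.exp (-ε * r)))
    (fun l => ENNReal.ofReal (Real.exp (-ε * dist y (l.prod • o))))
  have h₂ := h₁.trans (h n y)
  have hpos : 0 < Real.exp (-ε * r) := Real.exp_pos _
  have e : {l : List G | ENNReal.ofReal (Real.exp (-ε * r)) ≤
      ENNReal.ofReal (Real.exp (-ε * dist y (l.prod • o)))} =
      {l | dist y (l.prod • o) ≤ r} := by
    ext l
    simp only [Set.mem_ofPred_eq]
    rw [ENNReal.ofReal_le_ofReal_iff (Real.exp_pos _).le, Real.exp_le_exp]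
    constructor <;> intro h <;> nlinarith
  rw [e] at h₂
  have e₂ : A * lam ^ n * Real.exp (-ε * dist y o) =
      Real.exp (-ε * r) * (A * lam ^ n * Real.exp (-ε * (dist y o - r))) := by
    rw [show -ε * dist y o = -ε * r + -ε * (dist y o - r) by ring, Real.exp_add]; ring
  rw [e₂, ENNReal.ofReal_mul hpos.le] at h₂
  exact (ENNReal.mul_le_mul_iff_right (by simpa using hpos) ENNReal.ofReal_ne_top).1 h₂

variable [IsIsometricSMul G X]

lemma dist_inv_smul (g : G) (x y : X) : dist (g⁻¹ • x) y = dist x (g • y) := by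
  rw [← dist_smul g (g⁻¹ • x), smul_inv_smul]

/-- Second-order Taylor bound, the quadratic term being at most $\varepsilon/2$. The linear term is
kept on the left so that integration in `ℝ≥0∞` needs no subtraction. -/
lemma exp_neg_add_le {ε B d d₀ : ℝ} (hε : 0 ≤ ε) (h1 : ε * B ≤ 1)
    (h2 : ε * B ^ 2 ≤ 1 / 2) (hd : |d - d₀| ≤ B) :
    Real.exp (-ε * (d - d₀)) + ε * d ≤ 1 + ε / 2 + ε * d₀ := by
  have habs : |-ε * (d - d₀)| ≤ 1 := by
    rw [abs_mul, abs_neg, abs_of_nonneg hε]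
    exact (mul_le_mul_of_nonneg_left hd hε).trans h1
  have h := (abs_le.1 (Real.abs_exp_sub_one_sub_id_le habs)).2
  have hsq : (d - d₀) ^ 2 ≤ B ^ 2 := sq_le_sq' (by linarith [(abs_le.1 hd).1]) (abs_le.1 hd).2
  have : (-ε * (d - d₀)) ^ 2 ≤ ε / 2 := by
    calc (-ε * (d - d₀)) ^ 2 = ε * (ε * (d - d₀) ^ 2) := by ring
      _ ≤ ε * (ε * B ^ 2) := by gcongr
      _ ≤ ε * (1 / 2) := by gcongr
      _ = ε / 2 := by ring
  linarith

/-- A positive drift away from every point makes the exponential of the distance contract. -/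
lemma exists_stepExp_exp_le_of_drift {R : ℝ} (hR0 : 0 ≤ R) {o : X} (hp : ∑' g, p g = 1)
    (hR : ∀ g, p g ≠ 0 → dist o (g • o) ≤ R) {n : ℕ}
    (hdrift : ∀ y : X, edist y o + 1 ≤ stepExp p n fun l => edist y (l.prod • o)) :
    ∃ ε ρ : ℝ, 0 < ε ∧ 0 < ρ ∧ ρ < 1 ∧ ∀ y : X,
      stepExp p n (fun l => ENNReal.ofReal (Real.exp (-ε * dist y (l.prod • o)))) ≤
        ENNReal.ofReal (ρ * Real.exp (-ε * dist y o)) := by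
  set B : ℝ := n * R + 1 with hB
  have hB1 : 1 ≤ B := by have : 0 ≤ n * R := by positivity
                         linarith
  -- The quadratic error $(\varepsilon B)^2$ is then at most half of the linear gain $\varepsilon$
  -- given by the drift.
  set ε : ℝ := 1 / (2 * B ^ 2) with hεdef
  have hε : 0 < ε := by positivity
  have h2 : ε * B ^ 2 ≤ 1 / 2 := by rw [hεdef]; field_simp; exact le_rfl
  have h1 : ε * B ≤ 1 := by nlinarith
  have hε1 : ε ≤ 1 / 2 := (le_mul_of_one_le_right hε.le (one_le_pow₀ hB1)).trans h2
  refine ⟨ε, 1 - ε / 2, hε, by linarith, by linarith, fun y => ?_⟩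
  have key : stepExp p n (fun l => ENNReal.ofReal
      (Real.exp (-ε * (dist y (l.prod • o) - dist y o)))) ≤ ENNReal.ofReal (1 - ε / 2) := by
    have hsum : stepExp p n (fun l => ENNReal.ofReal
        (Real.exp (-ε * (dist y (l.prod • o) - dist y o)))) +
        ENNReal.ofReal ε * stepExp p n (fun l => edist y (l.prod • o)) ≤
        ENNReal.ofReal (1 + ε / 2 + ε * dist y o) := by
      rw [← stepExp_const_mul, ← stepExp_add]
      refine stepExp_le_of_le hp fun l hl hl' => ?_
      rw [edist_dist, ← ENNReal.ofReal_mul hε.le, ← ENNReal.ofReal_add (Real.exp_pos _).le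
        (by positivity)]
      refine ENNReal.ofReal_le_ofReal (exp_neg_add_le hε.le h1 h2 ?_)
      have h₃ := dist_list_prod_smul_le l fun a ha => hR a (hl' a ha)
      rw [hl] at h₃
      have h₄ := abs_dist_sub_le (l.prod • o) o y
      rw [dist_comm (l.prod • o) y, dist_comm o y, dist_comm (l.prod • o) o] at h₄
      linarith
    have h₅ : ENNReal.ofReal (ε * dist y o + ε) ≤
        ENNReal.ofReal ε * stepExp p n (fun l => edist y (l.prod • o)) := by
      refine le_trans (le_of_eq ?_) (mul_le_mul_right (hdrift y) _)
      rw [edist_dist, ← ENNReal.ofReal_one, ← ENNReal.ofReal_add dist_nonneg zero_le_one,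
        ← ENNReal.ofReal_mul hε.le]
      congr 1; ring
    have h₆ : ENNReal.ofReal (1 + ε / 2 + ε * dist y o) =
        ENNReal.ofReal (1 - ε / 2) + ENNReal.ofReal (ε * dist y o + ε) := by
      rw [← ENNReal.ofReal_add (by linarith) (by positivity)]
      congr 1; ring
    rw [h₆] at hsum
    exact (ENNReal.add_le_add_iff_right ENNReal.ofReal_ne_top).1
      ((add_le_add_right h₅ _).trans hsum)
  calc stepExp p n (fun l => ENNReal.ofReal (Real.exp (-ε * dist y (l.prod • o))))
      = ENNReal.ofReal (Real.exp (-ε * dist y o)) * stepExp p n (fun l => ENNReal.ofReal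
          (Real.exp (-ε * (dist y (l.prod • o) - dist y o)))) := by
        rw [← stepExp_const_mul]
        refine stepExp_congr fun l _ => ?_
        rw [← ENNReal.ofReal_mul (Real.exp_pos _).le, ← Real.exp_add]
        congr 2; ring
    _ ≤ ENNReal.ofReal (Real.exp (-ε * dist y o)) * ENNReal.ofReal (1 - ε / 2) := by gcongr
    _ = _ := by rw [← ENNReal.ofReal_mul (Real.exp_pos _).le, mul_comm]

/-- Since the contraction is uniform in $y$, it can be iterated after replacing $y$ by its image
under the inverse of the past. The first `m % n` steps cost a factor $e^{\varepsilon nR}$ and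
rounding the number of iterations costs $1/\rho$. -/
lemma exists_hasExpDecay {R : ℝ} (hR0 : 0 ≤ R) {o : X} (hp : ∑' g, p g = 1)
    (hR : ∀ g, p g ≠ 0 → dist o (g • o) ≤ R) {n : ℕ} (hn : 0 < n)
    (hdrift : ∀ y : X, edist y o + 1 ≤ stepExp p n fun l => edist y (l.prod • o)) :
    ∃ ε A lam : ℝ, 0 < ε ∧ 0 < A ∧ 0 < lam ∧ lam < 1 ∧ HasExpDecay p o ε A lam := by
  obtain ⟨ε, ρ, hε, hρ0, hρ1, h⟩ := exists_stepExp_exp_le_of_drift hR0 hp hR hdrift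
  have hmult : ∀ (q : ℕ) (y : X),
      stepExp p (n * q) (fun l => ENNReal.ofReal (Real.exp (-ε * dist y (l.prod • o)))) ≤
        ENNReal.ofReal (ρ ^ q * Real.exp (-ε * dist y o)) := by
    intro q
    induction q with
    | zero => intro y; simp [stepExp]
    | succ q ih =>
      intro y
      rw [Nat.mul_succ, add_comm, stepExp_append]
      calc _ ≤ stepExp p n (fun l => ENNReal.ofReal (ρ ^ q) *
            ENNReal.ofReal (Real.exp (-ε * dist y (l.prod • o)))) := by
            refine stepExp_mono fun l _ _ => ?_
            have := ih (l.prod⁻¹ • y)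
            simp only [dist_inv_smul, ← mul_smul] at this
            simpa only [List.prod_append, ← ENNReal.ofReal_mul (pow_nonneg hρ0.le q)] using this
        _ ≤ ENNReal.ofReal (ρ ^ q) * ENNReal.ofReal (ρ * Real.exp (-ε * dist y o)) := by
            rw [stepExp_const_mul]; gcongr; exact h y
        _ = _ := by
            rw [← ENNReal.ofReal_mul (pow_nonneg hρ0.le q)]; congr 1; ring
  set lam : ℝ := ρ ^ ((n : ℝ)⁻¹) with hlam
  have hlamn : lam ^ n = ρ := Real.rpow_inv_natCast_pow hρ0.le hn.ne'
  have hlam0 : 0 < lam := Real.rpow_pos_of_pos hρ0 _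
  have hlam1 : lam < 1 := Real.rpow_lt_one hρ0.le hρ1 (by positivity)
  refine ⟨ε, Real.exp (ε * (n * R)) / ρ, lam, hε, by positivity, hlam0, hlam1, fun m y => ?_⟩
  have hm : m = m % n + n * (m / n) := (Nat.mod_add_div m n).symm
  have hmod : m % n ≤ n := (Nat.mod_lt m hn).le
  conv_lhs => rw [hm]
  rw [stepExp_append]
  have hlast : ρ ^ (m / n) * ρ ≤ lam ^ m := by
    rw [← pow_succ, ← hlamn, ← pow_mul]
    refine pow_le_pow_of_le_one hlam0.le hlam1.le ?_
    rw [Nat.mul_succ]; omega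
  refine stepExp_le_of_le hp fun l hl hl' => ?_
  have h₁ := hmult (m / n) (l.prod⁻¹ • y)
  simp only [dist_inv_smul, ← mul_smul] at h₁
  simp only [List.prod_append]
  refine h₁.trans (ENNReal.ofReal_le_ofReal ?_)
  have h₂ := dist_list_prod_smul_le l fun a ha => hR a (hl' a ha)
  have h₃ : (l.length : ℝ) * R ≤ n * R := by rw [hl]; gcongr
  have h₄ := dist_triangle y (l.prod • o) o
  rw [dist_comm (l.prod • o) o] at h₄
  calc ρ ^ (m / n) * Real.exp (-ε * dist y (l.prod • o))
      ≤ lam ^ m / ρ * Real.exp (ε * (n * R) + -ε * dist y o) := by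
        gcongr
        · rwa [le_div_iff₀ hρ0]
        · nlinarith
    _ = _ := by rw [Real.exp_add]; ring

/-- A path which stays away from `w` does not cross over `w`, if it is not exponentially long. -/
lemma FourPoint.gp_ge_of_path {δ : ℝ} (hδ : FourPoint X δ) {w : X} {x : ℕ → X} {a : ℝ}
    (h₀ : ∀ j, a ≤ dist w (x j)) (h₁ : ∀ j, a ≤ gp w (x j) (x (j + 1))) (k i n : ℕ)
    (hn : n ≤ 2 ^ k) : a - k * δ ≤ gp w (x i) (x (i + n)) := by
  induction k generalizing i n with
  | zero =>
    have hn : n = 0 ∨ n = 1 := by rw [pow_zero] at hn; omega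
    rcases hn with rfl | rfl
    · have : gp w (x i) (x i) = dist w (x i) := by simp [gp]
      simpa [this] using h₀ i
    · simpa using h₁ i
  | succ k ih =>
    rw [pow_succ] at hn
    have e : n = n / 2 + (n - n / 2) := by omega
    have k₁ := ih i (n / 2) (by omega)
    have k₂ := ih (i + n / 2) (n - n / 2) (by omega)
    rw [add_assoc, ← e] at k₂
    have k₃ := hδ w (x i) (x (i + n / 2)) (x (i + n))
    push_cast
    rcases min_le_iff.1 k₃ with k₃ | k₃ <;> linarith

/-- Let $y'$ be the point at distance $r$ from $o$ on the way to $y$. Ending in the direction of $y$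
forces the path to come within $r/2$ of $y'$, since it is too short to go around that ball: a detour
has length exponential in the radius. Each of the $n+1$ times has a small probability of such a
visit. -/
lemma HasExpDecay.stepProb_gp_le {δ R : ℝ} (hδ : FourPoint X δ) (hgeo : HasGeodesicPoints X)
    {o : X} (hp : ∑' g, p g = 1) (hR0 : 0 ≤ R) (hR : ∀ g, p g ≠ 0 → dist o (g • o) ≤ R)
    {ε A lam : ℝ} (hε : 0 < ε) (hA : 0 < A) (hlam0 : 0 < lam) (hlam1 : lam < 1)
    (h : HasExpDecay p o ε A lam) {n k : ℕ} (hn : n ≤ 2 ^ k) {r : ℝ} (hr0 : 0 ≤ r)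
    (hr : k * δ + δ + R < r / 2) (y : X) :
    stepProb p n {l | r ≤ gp o y (l.prod • o)} ≤
      ENNReal.ofReal ((n + 1) * (A * Real.exp (-ε * (r / 2)))) := by
  by_cases hy : dist o y < r
  · refine (stepProb_mono (B := ∅) fun l _ _ hl => ?_).trans ?_
    · have h₁ : r ≤ gp o y (l.prod • o) := hl
      have h₂ := gp_le_dist_left o y (l.prod • o)
      linarith
    · rw [stepProb_empty]; exact bot_le
  push Not at hy
  obtain ⟨y', hy₁, hy₂⟩ := hgeo o y r hr0 hy
  have hsub : stepProb p n {l | r ≤ gp o y (l.prod • o)} ≤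
      stepProb p n {l | ∃ j < n + 1, l ∈ {l : List G | l.take j ∈
        {l : List G | dist y' (l.prod • o) ≤ r / 2}}} := by
    refine stepProb_mono fun l hl hl' hgp => ?_
    have hgp : r ≤ gp o y (l.prod • o) := hgp
    by_contra hcon
    simp only [Set.mem_ofPred_eq, not_exists, not_and, not_le] at hcon
    -- Prefixes are constant from time $n$ on, which extends the path to all times.
    have hfar : ∀ j, r / 2 < dist y' ((l.take j).prod • o) := by
      intro j
      rcases lt_or_ge j (n + 1) with hj | hj
      · exact hcon j hj
      · have := hcon n (by omega)
        rwa [List.take_of_length_le (by omega)] at this ⊢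
    have hstep : ∀ j, dist ((l.take j).prod • o) ((l.take (j + 1)).prod • o) ≤ R := by
      intro j
      rw [List.take_add_one, List.prod_append, mul_smul, dist_smul]
      rcases hj : l[j]? with _ | g
      · simpa using hR0
      · simpa using hR g (hl' g (List.mem_of_getElem? hj))
    have hpath := hδ.gp_ge_of_path (w := y') (x := fun j => (l.take j).prod • o) (a := r / 2 - R)
      (fun j => by have := hfar j; linarith)
      (fun j => by
        have h₁ := hfar j
        have h₂ := hstep j
        have h₃ := dist_sub_dist_le_gp y' ((l.take j).prod • o) ((l.take (j + 1)).prod • o)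
        linarith) k 0 n hn
    simp only [zero_add, List.take_zero, List.prod_nil, one_smul] at hpath
    rw [List.take_of_length_le hl.le] at hpath
    have h₁ := gp_add_gp o y' (l.prod • o)
    have h₂ := hδ o y' y (l.prod • o)
    have h₃ : gp o y' y = r := by rw [gp, hy₁, hy₂]; ring
    have h₄ : r ≤ min (gp o y' y) (gp o y (l.prod • o)) := le_min h₃.ge hgp
    linarith
  refine hsub.trans ((stepProb_iUnion_le n (n + 1) _).trans ?_)
  have hterm : ∀ j ∈ Finset.range (n + 1),
      stepProb p n {l : List G | l.take j ∈ {l : List G | dist y' (l.prod • o) ≤ r / 2}} ≤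
        ENNReal.ofReal (A * Real.exp (-ε * (r / 2))) := by
    intro j hj
    rw [stepProb_take hp (Nat.lt_succ_iff.1 (Finset.mem_range.1 hj))]
    refine (h.stepProb_dist_le hε j y' (r / 2)).trans (ENNReal.ofReal_le_ofReal ?_)
    rw [dist_comm y' o, hy₁, show r - r / 2 = r / 2 by ring]
    have := pow_le_one₀ hlam0.le hlam1.le (n := j)
    gcongr
    exact mul_le_of_le_one_right hA.le this
  refine (Finset.sum_le_sum hterm).trans (le_of_eq ?_)
  rw [Finset.sum_const, Finset.card_range, nsmul_eq_mul, ← Nat.cast_succ,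
    ENNReal.ofReal_mul (Nat.cast_nonneg _), ENNReal.ofReal_natCast]

end Contraction

/-! ### Independence of blocks of steps. -/

section Blocks

variable {G : Type*} [Group G] {p : G → ℝ≥0∞}

/-- Successive trials, each of which fails with conditional probability at most `θ`. -/
lemma stepProb_forall_blocks_le {b : ℕ} {θ : ℝ≥0∞} {Bad : G → List G → Prop}
    (h : ∀ u, stepProb p b {l | Bad u l} ≤ θ) (hp : ∑' g, p g = 1) (L z : ℕ) (u : G) :
    stepProb p (b * L + z)
      {l | ∀ i < L, Bad (u * (l.take (b * i)).prod) ((l.drop (b * i)).take b)} ≤ θ ^ L := by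
  induction L generalizing u with
  | zero => simpa using stepProb_le_one hp _ _
  | succ L ih =>
    rw [show b * (L + 1) + z = b + (b * L + z) by ring, stepProb_append, pow_succ]
    calc _ ≤ stepExp p b (fun l => θ ^ L * Set.indicator {l | Bad u l} 1 l) := by
          refine stepExp_mono fun l hl _ => ?_
          by_cases hbad : Bad u l
          · have : l ∈ {l | Bad u l} := hbad
            rw [Set.indicator_of_mem this, Pi.one_apply, mul_one]
            refine le_trans (stepProb_mono fun l' _ _ hl' => ?_) (ih (u * l.prod))
            intro i hi
            have := hl' (i + 1) (by omega)
            have e : b * (i + 1) = l.length + b * i := by rw [hl]; ring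
            rw [e, List.take_length_add_append, List.drop_length_add_append, List.prod_append,
              ← mul_assoc] at this
            exact this
          · refine le_trans (stepProb_mono (B := ∅) fun l' _ _ hl' => ?_)
              ((stepProb_empty _).trans_le bot_le)
            have := hl' 0 (by omega)
            rw [Nat.mul_zero, List.take_zero, List.prod_nil, mul_one, List.drop_zero, ← hl,
              List.take_left] at this
            exact hbad this
      _ ≤ θ ^ L * θ := by
          rw [stepExp_const_mul]
          gcongr
          exact h u

lemma stepProb_forall_blocks_after_le {b : ℕ} {θ : ℝ≥0∞} {Bad : G → List G → Prop}
    (h : ∀ u, stepProb p b {l | Bad u l} ≤ θ) (hp : ∑' g, p g = 1) (a L z : ℕ) :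
    stepProb p (a + (b * L + z))
      {l | ∀ i < L, Bad (l.take (a + b * i)).prod ((l.drop (a + b * i)).take b)} ≤ θ ^ L := by
  rw [stepProb_append]
  refine stepExp_le_of_le hp fun l hl _ => ?_
  refine le_trans (stepProb_mono fun l' _ _ hl' => ?_)
    (stepProb_forall_blocks_le h hp L z l.prod)
  intro i hi
  have := hl' i hi
  rw [← hl, List.take_length_add_append, List.drop_length_add_append, List.prod_append] at this
  exact this

/-- The products of three pieces of the walk are independent. -/
lemma stepProb_pieces (hp : ∑' g, p g = 1) (n₁ k m n₃ : ℕ) (Q : G → G → G → Prop) :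
    stepProb p (n₁ + (k + (m + n₃))) {l | Q (l.take n₁).prod ((l.drop (n₁ + k)).take m).prod
      (l.drop (n₁ + k + m)).prod} =
    stepExp p n₁ fun l₁ => stepExp p m fun l₂ => stepProb p n₃ {l₃ | Q l₁.prod l₂.prod l₃.prod} := by
  rw [stepProb_append]
  refine stepExp_congr fun l₁ h₁ => ?_
  rw [stepProb_append]
  have : ∀ l : List G, l.length = k → stepProb p (m + n₃) {l' | l ++ l' ∈ {l' | l₁ ++ l' ∈
      {l : List G | Q (l.take n₁).prod ((l.drop (n₁ + k)).take m).prod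
        (l.drop (n₁ + k + m)).prod}}} =
      stepExp p m fun l₂ => stepProb p n₃ {l₃ | Q l₁.prod l₂.prod l₃.prod} := by
    intro l hl
    rw [stepProb_append]
    refine stepExp_congr fun l₂ h₂ => ?_
    congr 1
    ext l₃
    change Q _ _ _ ↔ Q _ _ _
    have e₁ : (l₁ ++ (l ++ (l₂ ++ l₃))).take n₁ = l₁ := by rw [← h₁, List.take_left]
    have e₂ : (l₁ ++ (l ++ (l₂ ++ l₃))).drop (n₁ + k) = l₂ ++ l₃ := by
      rw [← h₁, ← hl, List.drop_length_add_append, List.drop_left]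
    have e₃ : (l₁ ++ (l ++ (l₂ ++ l₃))).drop (n₁ + k + m) = l₃ := by
      rw [← List.drop_drop, e₂, ← h₂, List.drop_left]
    rw [e₁, e₂, e₃, ← h₂, List.take_left]
  rw [stepExp_congr this, stepExp_const hp]

/-- The event may involve all three pieces: the other two are frozen and only one is random. This
handles the cyclic junction of $z$ with $u$. -/
lemma stepProb_pieces_le_of_left (hp : ∑' g, p g = 1) {n₁ : ℕ} (k m n₃ : ℕ)
    {Q : G → G → G → Prop} {c : ℝ≥0∞} (h : ∀ v z, stepProb p n₁ {l | Q l.prod v z} ≤ c) :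
    stepProb p (n₁ + (k + (m + n₃))) {l | Q (l.take n₁).prod ((l.drop (n₁ + k)).take m).prod
      (l.drop (n₁ + k + m)).prod} ≤ c := by
  rw [stepProb_pieces hp, stepExp_comm]
  refine stepExp_le_of_le hp fun l₂ _ _ => ?_
  simp only [stepProb]
  rw [stepExp_comm]
  exact stepExp_le_of_le hp fun l₃ _ _ => h l₂.prod l₃.prod

lemma stepProb_pieces_le_of_mid (hp : ∑' g, p g = 1) (n₁ k : ℕ) {m : ℕ} (n₃ : ℕ)
    {Q : G → G → G → Prop} {c : ℝ≥0∞} (h : ∀ u z, stepProb p m {l | Q u l.prod z} ≤ c) :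
    stepProb p (n₁ + (k + (m + n₃))) {l | Q (l.take n₁).prod ((l.drop (n₁ + k)).take m).prod
      (l.drop (n₁ + k + m)).prod} ≤ c := by
  rw [stepProb_pieces hp]
  refine stepExp_le_of_le hp fun l₁ _ _ => ?_
  simp only [stepProb]
  rw [stepExp_comm]
  exact stepExp_le_of_le hp fun l₃ _ _ => h l₁.prod l₃.prod

lemma stepProb_pieces_le_of_right (hp : ∑' g, p g = 1) (n₁ k m : ℕ) {n₃ : ℕ}
    {Q : G → G → G → Prop} {c : ℝ≥0∞} (h : ∀ u v, stepProb p n₃ {l | Q u v l.prod} ≤ c) :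
    stepProb p (n₁ + (k + (m + n₃))) {l | Q (l.take n₁).prod ((l.drop (n₁ + k)).take m).prod
      (l.drop (n₁ + k + m)).prod} ≤ c := by
  rw [stepProb_pieces hp]
  exact stepExp_le_of_le hp fun l₁ _ _ => stepExp_le_of_le hp fun l₂ _ _ => h l₁.prod l₂.prod

end Blocks

/-! ### Aligned insertions of the WPD element. -/

section Insertion

variable {G : Type*} [Group G] {X : Type*} [MetricSpace X] [MulAction G X] {p : G → ℝ≥0∞}

/-- `g` is of the form `s i * H * s j`, aligned with the preceding `u` and the following `v`. -/
def IsAlignedInsertion (o : X) (C : ℝ) (s : Fin 12 → G) (H u g v : G) : Prop :=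
  ∃ i j, g = s i * H * s j ∧ gp o (u⁻¹ • o) (s i • o) ≤ C ∧ gp o ((s i)⁻¹ • o) (H • o) ≤ C ∧
    gp o (H⁻¹ • o) (s j • o) ≤ C ∧ gp o ((s j)⁻¹ • o) (v • o) ≤ C

lemma exists_not_and_not {P Q : Fin 12 → Prop} (hP : ∀ i j, P i → P j → i = j)
    (hQ : ∀ i j, Q i → Q j → i = j) : ∃ i, ¬ P i ∧ ¬ Q i := by
  by_contra! hcon
  have h : ∀ i, P i ∨ Q i := fun i => by
    by_cases hi : P i
    · exact Or.inl hi
    · exact Or.inr (hcon i hi)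
  have n₁ : (0 : Fin 12) ≠ 1 := by decide
  have n₂ : (0 : Fin 12) ≠ 2 := by decide
  have n₃ : (1 : Fin 12) ≠ 2 := by decide
  rcases h 0 with h0 | h0 <;> rcases h 1 with h1 | h1 <;> rcases h 2 with h2 | h2
  · exact n₁ (hP _ _ h0 h1)
  · exact n₁ (hP _ _ h0 h1)
  · exact n₂ (hP _ _ h0 h2)
  · exact n₃ (hQ _ _ h1 h2)
  · exact n₃ (hP _ _ h1 h2)
  · exact n₂ (hQ _ _ h0 h2)
  · exact n₁ (hQ _ _ h0 h1)
  · exact n₁ (hQ _ _ h0 h1)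

/-- On each side of $H$ two directions have to be avoided, and each excludes at most one index. The
choice of $i$ depends only on $u$ and $H$, that of $j$ only on $H$ and $v$. -/
lemma IsSchottky.exists_isAlignedInsertion {o : X} {C D : ℝ} {s : Fin 12 → G}
    (hs : IsSchottky o C D s) (H u v : G) :
    ∃ i j, IsAlignedInsertion o C s H u (s i * H * s j) v := by
  obtain ⟨i, hi₁, hi₂⟩ := exists_not_and_not (hs.unique (u⁻¹ • o)) (hs.unique_inv (H • o))
  obtain ⟨j, hj₁, hj₂⟩ := exists_not_and_not (hs.unique (H⁻¹ • o)) (hs.unique_inv (v • o))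
  refine ⟨i, j, i, j, rfl, not_lt.1 hi₁, ?_, not_lt.1 hj₁, ?_⟩
  · rw [gp_comm]; exact not_lt.1 hi₂
  · rw [gp_comm]; exact not_lt.1 hj₂

/-- Whatever precedes and follows, a block of steps realizes an aligned insertion with positive
probability. -/
lemma IsSchottky.exists_stepProb_not_aligned_le {o : X} {C D : ℝ} {s : Fin 12 → G}
    (hs : IsSchottky o C D s) (hp : ∑' g, p g = 1) {k : ℕ} {H : G}
    (hpos : ∀ i j, 0 < prodMass p k (s i * H * s j)) :
    ∃ θ : ℝ, 0 < θ ∧ θ < 1 ∧ ∀ (m : ℕ) (u : G), stepProb p (k + m)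
      {l | ¬ IsAlignedInsertion o C s H u (l.take k).prod (l.drop k).prod} ≤ ENNReal.ofReal θ := by
  obtain ⟨⟨i₀, j₀⟩, -, hmin⟩ := Finset.exists_min_image (Finset.univ : Finset (Fin 12 × Fin 12))
    (fun x => prodMass p k (s x.1 * H * s x.2)) ⟨(0, 0), Finset.mem_univ _⟩
  set α := prodMass p k (s i₀ * H * s j₀) with hα
  have hα0 : 0 < α := hpos i₀ j₀
  have hα1 : α ≤ 1 := stepProb_le_one hp _ _
  have hαt : α ≠ ∞ := ne_top_of_le_ne_top ENNReal.one_ne_top hα1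
  have hα0' : 0 < α.toReal := ENNReal.toReal_pos hα0.ne' hαt
  have hα1' : α.toReal ≤ 1 := by simpa using ENNReal.toReal_mono ENNReal.one_ne_top hα1
  -- Half of $\alpha$ keeps the failure bound positive even if $\alpha=1$; it is divided by later.
  refine ⟨1 - α.toReal / 2, by linarith, by linarith, fun m u => ?_⟩
  have hone : ∀ v : G, stepProb p k {l | ¬ IsAlignedInsertion o C s H u l.prod v} ≤
      ENNReal.ofReal (1 - α.toReal / 2) := by
    intro v
    obtain ⟨i, j, hij⟩ := hs.exists_isAlignedInsertion H u v
    have h₁ : α ≤ stepProb p k {l | IsAlignedInsertion o C s H u l.prod v} := by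
      refine (hmin (i, j) (Finset.mem_univ _)).trans (stepProb_mono fun l _ _ hl => ?_)
      have hl : l.prod = s i * H * s j := hl
      change IsAlignedInsertion o C s H u l.prod v
      rwa [hl]
    have h₂ := stepProb_add_compl hp k {l | IsAlignedInsertion o C s H u l.prod v}
    have h₃ : α + stepProb p k {l | ¬ IsAlignedInsertion o C s H u l.prod v} ≤ 1 := by
      rw [← h₂]; exact add_le_add_left h₁ _
    have h₄ := ENNReal.le_sub_of_add_le_left hαt h₃
    refine h₄.trans ?_
    rw [← ENNReal.ofReal_toReal hαt, ← ENNReal.ofReal_one, ← ENNReal.ofReal_sub _ hα0'.le]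
    refine ENNReal.ofReal_le_ofReal ?_
    rw [ENNReal.toReal_ofReal hα0'.le]
    linarith
  rw [stepProb_append]
  simp only [stepProb]
  -- The last $m$ steps are conditioned on first, so that the indices may be chosen knowing $v$.
  rw [stepExp_comm]
  refine stepExp_le_of_le hp fun l' _ _ => le_trans (le_of_eq ?_) (hone l'.prod)
  refine stepExp_congr fun l hl => ?_
  have e : (l ++ l').take k = l ∧ (l ++ l').drop k = l' := by
    rw [← hl]; exact ⟨List.take_left, List.drop_left⟩
  by_cases h : IsAlignedInsertion o C s H u l.prod l'.prod
  · rw [Set.indicator_of_notMem, Set.indicator_of_notMem]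
    · exact not_not.2 h
    · change ¬ ¬ IsAlignedInsertion o C s H u ((l ++ l').take k).prod ((l ++ l').drop k).prod
      rw [e.1, e.2]; exact not_not.2 h
  · rw [Set.indicator_of_mem, Set.indicator_of_mem]
    · rfl
    · exact h
    · change ¬ IsAlignedInsertion o C s H u ((l ++ l').take k).prod ((l ++ l').drop k).prod
      rwa [e.1, e.2]

end Insertion

/-! ### Probability that no block yields a WPD factorization. -/

section Estimate

variable {G : Type*} [Group G] {X : Type*} [MetricSpace X] [MulAction G X] [IsIsometricSMul G X]
  {p : G → ℝ≥0∞}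

/-- `u`, `v` or `z` is short, or one of the pairs `z, u` and `v, z` is badly aligned. -/
def IsDegenerate (o : X) (d r : ℝ) (u v z : G) : Prop :=
  dist o (u • o) ≤ d ∨ dist o (v • o) ≤ d ∨ dist o (z • o) ≤ d ∨
    r ≤ gp o (z⁻¹ • o) (u • o) ∨ r ≤ gp o (v⁻¹ • o) (z • o)

lemma isWPD_of_isAlignedInsertion {δ : ℝ} (hδ : FourPoint X δ) {o : X} {C D d r : ℝ}
    {s : Fin 12 → G} (hs : IsSchottky o C D s) (hC : 0 ≤ C) (hr : 0 ≤ r)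
    (hD : 2 * C + 3 * δ + 1 ≤ D) (hd : r + C + 3 * δ + 1 ≤ d) (hd' : 2 * r + 3 * δ + 1 ≤ d)
    {H : G} (hH : 2 * C + 3 * δ + 1 ≤ dist o (H • o))
    (hfin : (jointCoarseStab G (2 * (C + 2 * δ + 2 * δ) + 2 * δ + 1) o (H • o)).Finite)
    {u g v z : G} (hg : IsAlignedInsertion o C s H u g v) (hdeg : ¬ IsDegenerate o d r u v z) :
    IsWPD X (u * g * v * z) := by
  obtain ⟨i, j, rfl, h₁, h₂, h₃, h₄⟩ := hg
  simp only [IsDegenerate, not_or, not_le] at hdeg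
  obtain ⟨k₁, k₂, k₃, k₄, k₅⟩ := hdeg
  have := isWPD_of_aligned hδ hC hr k₄.le h₁ h₂ h₃ h₄ k₅.le (hd.trans k₁.le)
    (hD.trans (hs.le_dist i)) hH (hD.trans (hs.le_dist j)) (hd.trans k₂.le) (hd'.trans k₃.le) hfin
  simpa only [mul_assoc] using this

/-- Three short pieces and two bad junctions. The junction $z|u$ is estimated with $z$ frozen, the
junction $v|z$ with $v$ frozen, each direction bound being uniform in the target point. -/
lemma HasExpDecay.stepProb_isDegenerate_le {δ R : ℝ} (hδ : FourPoint X δ)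
    (hgeo : HasGeodesicPoints X) {o : X} (hp : ∑' g, p g = 1) (hR0 : 0 ≤ R)
    (hR : ∀ g, p g ≠ 0 → dist o (g • o) ≤ R) {ε A lam : ℝ} (hε : 0 < ε) (hA : 0 < A)
    (hlam0 : 0 < lam) (hlam1 : lam < 1) (h : HasExpDecay p o ε A lam) {d r : ℝ} (hr0 : 0 ≤ r)
    {n K : ℕ} (hn : n ≤ 2 ^ K) (hr : K * δ + δ + R < r / 2) {n₁ k m n₃ : ℕ} (hm₁ : m ≤ n₁)
    (hm₃ : m ≤ n₃) (hsum : n₁ + (k + (m + n₃)) ≤ n) :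
    stepProb p (n₁ + (k + (m + n₃))) {l | IsDegenerate o d r (l.take n₁).prod
      ((l.drop (n₁ + k)).take m).prod (l.drop (n₁ + k + m)).prod} ≤
      ENNReal.ofReal (3 * (A * lam ^ m * Real.exp (ε * d)) +
        2 * ((n + 1) * (A * Real.exp (-ε * (r / 2))))) := by
  set a := A * lam ^ m * Real.exp (ε * d) with ha
  set b := (n + 1) * (A * Real.exp (-ε * (r / 2))) with hb
  have ha0 : 0 ≤ a := by positivity
  have hb0 : 0 ≤ b := by positivity
  have hshort : ∀ j, m ≤ j → stepProb p j {l | dist o (l.prod • o) ≤ d} ≤ ENNReal.ofReal a := by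
    intro j hj
    refine (h.stepProb_dist_le hε j o d).trans (ENNReal.ofReal_le_ofReal ?_)
    rw [dist_self, zero_sub, neg_mul_neg, ha]
    gcongr A * ?_ * _
    exact pow_le_pow_of_le_one hlam0.le hlam1.le hj
  have halign : ∀ j, j ≤ n → ∀ y : X, stepProb p j {l | r ≤ gp o y (l.prod • o)} ≤
      ENNReal.ofReal b := by
    intro j hj y
    refine (h.stepProb_gp_le hδ hgeo hp hR0 hR hε hA hlam0 hlam1 (hj.trans hn) hr0 hr y).trans
      (ENNReal.ofReal_le_ofReal ?_)
    rw [hb]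
    gcongr
  have h₁ := stepProb_pieces_le_of_left (p := p) hp (n₁ := n₁) k m n₃
    (Q := fun u _ _ => dist o (u • o) ≤ d) fun _ _ => hshort n₁ hm₁
  have h₂ := stepProb_pieces_le_of_mid (p := p) hp n₁ k (m := m) n₃
    (Q := fun _ v _ => dist o (v • o) ≤ d) fun _ _ => hshort m le_rfl
  have h₃ := stepProb_pieces_le_of_right (p := p) hp n₁ k m (n₃ := n₃)
    (Q := fun _ _ z => dist o (z • o) ≤ d) fun _ _ => hshort n₃ hm₃
  have h₄ := stepProb_pieces_le_of_left (p := p) hp (n₁ := n₁) k m n₃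
    (Q := fun u _ z => r ≤ gp o (z⁻¹ • o) (u • o)) fun _ z => halign n₁ (by omega) (z⁻¹ • o)
  have h₅ := stepProb_pieces_le_of_right (p := p) hp n₁ k m (n₃ := n₃)
    (Q := fun _ v z => r ≤ gp o (v⁻¹ • o) (z • o)) fun _ v => halign n₃ (by omega) (v⁻¹ • o)
  have e : ENNReal.ofReal (3 * a + 2 * b) = ENNReal.ofReal a + (ENNReal.ofReal a +
      (ENNReal.ofReal a + (ENNReal.ofReal b + ENNReal.ofReal b))) := by
    rw [← ENNReal.ofReal_add hb0 hb0, ← ENNReal.ofReal_add ha0 (by positivity),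
      ← ENNReal.ofReal_add ha0 (by positivity), ← ENNReal.ofReal_add ha0 (by positivity)]
    congr 1; ring
  rw [e]
  simp only [IsDegenerate]
  refine (stepProb_or_le _ _ _).trans (add_le_add h₁ ?_)
  refine (stepProb_or_le _ _ _).trans (add_le_add h₂ ?_)
  refine (stepProb_or_le _ _ _).trans (add_le_add h₃ ?_)
  exact (stepProb_or_le _ _ _).trans (add_le_add h₄ h₅)

/-- The walk is WPD unless all insertions fail or one of the blocks is degenerate. -/
lemma stepProb_not_isWPD_le {δ R : ℝ} (hδ : FourPoint X δ)
    (hgeo : HasGeodesicPoints X) {o : X} (hp : ∑' g, p g = 1) (hR0 : 0 ≤ R)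
    (hR : ∀ g, p g ≠ 0 → dist o (g • o) ≤ R) {ε A lam : ℝ} (hε : 0 < ε) (hA : 0 < A)
    (hlam0 : 0 < lam) (hlam1 : lam < 1) (h : HasExpDecay p o ε A lam)
    {C D d r : ℝ} {s : Fin 12 → G} (hs : IsSchottky o C D s) (hC : 0 ≤ C) (hr0 : 0 ≤ r)
    (hD : 2 * C + 3 * δ + 1 ≤ D) (hd : r + C + 3 * δ + 1 ≤ d) (hd' : 2 * r + 3 * δ + 1 ≤ d)
    {H : G} (hH : 2 * C + 3 * δ + 1 ≤ dist o (H • o))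
    (hfin : (jointCoarseStab G (2 * (C + 2 * δ + 2 * δ) + 2 * δ + 1) o (H • o)).Finite)
    {θ : ℝ} {k m : ℕ} (hkm : k ≤ m)
    (hθ : ∀ u : G, stepProb p m
      {l | ¬ IsAlignedInsertion o C s H u (l.take k).prod (l.drop k).prod} ≤ ENNReal.ofReal θ)
    {L z n K : ℕ} (hz : m ≤ z) (hnL : n = m + (m * L + z)) (hn : n ≤ 2 ^ K)
    (hr : K * δ + δ + R < r / 2) :
    stepProb p n {l | ¬ IsWPD X l.prod} ≤ ENNReal.ofReal θ ^ L + L * ENNReal.ofReal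
      (3 * (A * lam ^ (m - k) * Real.exp (ε * d)) +
        2 * ((n + 1) * (A * Real.exp (-ε * (r / 2))))) := by
  -- Trial $i$ uses the block of $m$ steps after time $m+mi$: its first $k$ steps give the insertion
  -- and its last $m-k$ give $v$. The initial $m$ steps ensure that $u$ has at least $m$ steps.
  let Fail : ℕ → Set (List G) := fun i => {l | IsDegenerate o d r (l.take (m + m * i)).prod
    ((l.drop (m + m * i + k)).take (m - k)).prod (l.drop (m + m * i + k + (m - k))).prod}
  let Bad : G → List G → Prop := fun u l =>
    ¬ IsAlignedInsertion o C s H u (l.take k).prod (l.drop k).prod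
  have hcover : stepProb p n {l | ¬ IsWPD X l.prod} ≤ stepProb p n
      ({l | ∀ i < L, Bad (l.take (m + m * i)).prod ((l.drop (m + m * i)).take m)} ∪
        {l | ∃ i < L, l ∈ Fail i}) := by
    refine stepProb_mono fun l _ _ hl => ?_
    by_contra hcon
    rw [Set.mem_union, not_or] at hcon
    obtain ⟨hc₁, hc₂⟩ := hcon
    have hc₁ : ¬ ∀ i < L, Bad (l.take (m + m * i)).prod ((l.drop (m + m * i)).take m) := hc₁
    have hc₂ : ¬ ∃ i < L, l ∈ Fail i := hc₂
    push Not at hc₁ hc₂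
    obtain ⟨i, hi, hgood⟩ := hc₁
    have hdeg := hc₂ i hi
    have hgood := not_not.1 hgood
    set n₁ := m + m * i
    rw [List.drop_take, List.take_take, min_eq_left hkm, List.drop_drop] at hgood
    have e : l.prod = (l.take n₁).prod * ((l.drop n₁).take k).prod *
        ((l.drop (n₁ + k)).take (m - k)).prod * (l.drop (n₁ + k + (m - k))).prod := by
      rw [mul_assoc, ← List.drop_drop (l := l) (i := m - k), List.prod_take_mul_prod_drop,
        mul_assoc, ← List.drop_drop (l := l) (i := k), List.prod_take_mul_prod_drop,
        List.prod_take_mul_prod_drop]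
    refine hl ?_
    rw [e]
    exact isWPD_of_isAlignedInsertion hδ hs hC hr0 hD hd hd' hH hfin hgood hdeg
  refine hcover.trans ((stepProb_union_le _ _ _).trans (add_le_add ?_ ?_))
  · rw [hnL]
    exact stepProb_forall_blocks_after_le hθ hp m L z
  · refine (stepProb_iUnion_le n L Fail).trans ?_
    rw [← nsmul_eq_mul]
    refine (Finset.sum_le_card_nsmul _ _ _ fun i hi => ?_).trans (by rw [Finset.card_range])
    obtain ⟨j, hj⟩ := Nat.exists_eq_add_of_lt (Finset.mem_range.1 hi)
    have e : n = (m + m * i) + (k + ((m - k) + (z + m * j))) := by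
      have : k + (m - k) = m := by omega
      rw [hnL, hj]
      calc m + (m * (i + j + 1) + z) = m + m * i + (m + (z + m * j)) := by ring
        _ = _ := by rw [← add_assoc k, this]
    have := h.stepProb_isDegenerate_le hδ hgeo hp hR0 hR hε hA hlam0 hlam1 (d := d) hr0 hn hr
      (n₁ := m + m * i) (k := k) (m := m - k) (n₃ := z + m * j)
      (by have := Nat.zero_le (m * i); omega) (by have := Nat.zero_le (m * j); omega) e.ge
    rw [← e] at this
    exact this

end Estimate

/-! ### Elementary asymptotics. -/

section Asymptotics

/-- A path of $n<(m+1)^2$ steps needs only $K=O(\log m)$ dyadic subdivisions, so $K\delta$ is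
negligible against $r/2$ with $r=\kappa m/4$. Taking $K$ to be a small multiple of $m$ suffices. -/
lemma eventually_exists_sq_le_two_pow {κ δ : ℝ} (hκ : 0 < κ) (hδ : 0 ≤ δ) (R : ℝ) :
    ∀ᶠ m : ℕ in atTop, ∃ K : ℕ, (m + 1) ^ 2 ≤ 2 ^ K ∧ K * δ + δ + R < κ * m / 4 / 2 := by
  set t : ℝ := κ / (16 * (δ + 1)) with ht
  have ht0 : 0 < t := by positivity
  set q : ℝ := (2 : ℝ) ^ (-t) with hq
  have hq0 : 0 < q := Real.rpow_pos_of_pos two_pos _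
  have hq1 : q < 1 := Real.rpow_lt_one_of_one_lt_of_neg one_lt_two (by linarith)
  have hlim : Tendsto (fun m : ℕ => (m : ℝ) ^ 2 * q ^ m) atTop (𝓝 0) :=
    tendsto_pow_const_mul_const_pow_of_abs_lt_one 2 (by rwa [abs_of_pos hq0])
  have hev := hlim.eventually (gt_mem_nhds (show (0 : ℝ) < 1 / 8 by norm_num))
  have hbig : ∀ᶠ m : ℕ in atTop, (δ + R) * 16 / κ < m :=
    tendsto_natCast_atTop_atTop.eventually (eventually_gt_atTop _)
  filter_upwards [hev, hbig, eventually_ge_atTop 1] with m h₁ h₂ h₃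
  have hm1 : (1 : ℝ) ≤ m := by exact_mod_cast h₃
  refine ⟨⌊t * m⌋₊, ?_, ?_⟩
  · have hfl : t * m - 1 ≤ (⌊t * m⌋₊ : ℝ) := by
      have := Nat.lt_floor_add_one (t * m); linarith
    have e : (2 : ℝ) ^ (t * m - 1) = (q ^ m)⁻¹ / 2 := by
      rw [Real.rpow_sub two_pos, Real.rpow_one, hq, ← Real.rpow_natCast, ← Real.rpow_mul two_pos.le,
        ← Real.rpow_neg two_pos.le]
      congr 2; ring
    have h₄ : ((m : ℝ) + 1) ^ 2 ≤ (2 : ℝ) ^ (⌊t * m⌋₊ : ℝ) := by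
      calc ((m : ℝ) + 1) ^ 2 ≤ 4 * (m : ℝ) ^ 2 := by nlinarith
        _ ≤ (q ^ m)⁻¹ / 2 := by
          have hqm : 0 < q ^ m := pow_pos hq0 m
          have : (m : ℝ) ^ 2 ≤ 1 / 8 * (q ^ m)⁻¹ := by
            rw [← div_eq_mul_inv, le_div_iff₀ hqm]; exact h₁.le
          linarith
        _ = (2 : ℝ) ^ (t * m - 1) := e.symm
        _ ≤ _ := Real.rpow_le_rpow_of_exponent_le one_le_two hfl
    rw [Real.rpow_natCast] at h₄
    exact_mod_cast h₄
  · have hfl : (⌊t * m⌋₊ : ℝ) ≤ t * m := Nat.floor_le (by positivity)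
    have h₅ : (⌊t * m⌋₊ : ℝ) * δ ≤ κ * m / 16 := by
      calc (⌊t * m⌋₊ : ℝ) * δ ≤ t * m * (δ + 1) := by gcongr; linarith
        _ = κ * m / 16 := by rw [ht]; field_simp
    rw [div_lt_iff₀ hκ] at h₂
    linarith

lemma exists_cube_mul_pow_le {q : ℝ} (hq0 : 0 ≤ q) (hq1 : q < 1) :
    ∃ B : ℝ, 0 ≤ B ∧ ∀ m : ℕ, ((m : ℝ) + 1) ^ 3 * q ^ m ≤ B := by
  have hlim : Tendsto (fun m : ℕ => (m : ℝ) ^ 3 * q ^ m) atTop (𝓝 0) :=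
    tendsto_pow_const_mul_const_pow_of_abs_lt_one 3 (by rwa [abs_of_nonneg hq0])
  obtain ⟨B, hB⟩ := hlim.bddAbove_range
  have hB' : ∀ m : ℕ, (m : ℝ) ^ 3 * q ^ m ≤ B := fun m => hB ⟨m, rfl⟩
  have hB0 : 0 ≤ B := by simpa using hB' 0
  refine ⟨8 * B + 1, by positivity, fun m => ?_⟩
  rcases Nat.eq_zero_or_pos m with rfl | hm
  · norm_num; linarith
  have hm1 : (1 : ℝ) ≤ m := by exact_mod_cast hm
  have h₁ : ((m : ℝ) + 1) ^ 3 ≤ (2 * m) ^ 3 := by gcongr; linarith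
  calc ((m : ℝ) + 1) ^ 3 * q ^ m ≤ (2 * m) ^ 3 * q ^ m := by gcongr
    _ = 8 * ((m : ℝ) ^ 3 * q ^ m) := by ring
    _ ≤ 8 * B + 1 := by linarith [hB' m]

/-- The factor $1/c$ pays for rounding $\sqrt n$ down; the second constant makes the bound exceed 1
for the finitely many small $n$. -/
lemma exists_le_rpow_sqrt {f : ℕ → ℝ≥0∞} (h1 : ∀ n, f n ≤ 1) {B₀ c : ℝ} (hB : 0 ≤ B₀)
    (hc0 : 0 < c) (hc1 : c < 1)
    (h : ∀ᶠ m : ℕ in atTop, ∀ n, Nat.sqrt n = m → f n ≤ ENNReal.ofReal (B₀ * c ^ m)) :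
    ∃ B : ℝ, 0 < B ∧ ∀ n : ℕ, f n ≤ ENNReal.ofReal (B * c ^ Real.sqrt n) := by
  obtain ⟨m₀, hm₀⟩ := eventually_atTop.1 h
  have hpos : ∀ x : ℝ, 0 < c ^ x := fun x => Real.rpow_pos_of_pos hc0 x
  refine ⟨B₀ / c + (c ^ ((m₀ : ℝ) + 1))⁻¹, by have := hpos (m₀ + 1); positivity, fun n => ?_⟩
  have hs : Real.sqrt n ≤ Nat.sqrt n + 1 := Real.real_sqrt_le_nat_sqrt_succ
  rw [add_mul]
  have hp₁ : 0 ≤ B₀ / c * c ^ Real.sqrt n := by have := hpos (Real.sqrt n); positivity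
  have hp₂ : 0 ≤ (c ^ ((m₀ : ℝ) + 1))⁻¹ * c ^ Real.sqrt n := by
    have h₁ := hpos (Real.sqrt n); have h₂ := hpos (m₀ + 1); positivity
  rcases le_or_gt m₀ (Nat.sqrt n) with hm | hm
  · refine (hm₀ _ hm n rfl).trans (ENNReal.ofReal_le_ofReal ?_)
    have h₁ : c ^ Nat.sqrt n ≤ c ^ Real.sqrt n / c := by
      rw [le_div_iff₀ hc0, ← pow_succ, ← Real.rpow_natCast]
      refine Real.rpow_le_rpow_of_exponent_ge hc0 hc1.le ?_
      push_cast; exact hs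
    calc B₀ * c ^ Nat.sqrt n ≤ B₀ * (c ^ Real.sqrt n / c) := by gcongr
      _ = B₀ / c * c ^ Real.sqrt n := by ring
      _ ≤ _ := le_add_of_nonneg_right hp₂
  · refine (h1 n).trans ?_
    rw [← ENNReal.ofReal_one]
    refine ENNReal.ofReal_le_ofReal ?_
    have h₁ : c ^ ((m₀ : ℝ) + 1) ≤ c ^ Real.sqrt n := by
      refine Real.rpow_le_rpow_of_exponent_ge hc0 hc1.le (hs.trans ?_)
      have : (Nat.sqrt n : ℝ) ≤ m₀ := by exact_mod_cast hm.le
      linarith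
    have h₂ : 1 ≤ (c ^ ((m₀ : ℝ) + 1))⁻¹ * c ^ Real.sqrt n := by
      rw [← div_eq_inv_mul, le_div_iff₀ (hpos _), one_mul]; exact h₁
    linarith

end Asymptotics

/-! ### Choice of the parameters. -/

section Conclusion

variable {G : Type*} [Group G] {X : Type*} [MetricSpace X] [MulAction G X] [IsIsometricSMul G X]
  {p : G → ℝ≥0∞}

lemma prodMass_schottkyElt_pos {a b : G} {ka kb : ℕ} (ha : 0 < prodMass p ka a)
    (hb : 0 < prodMass p kb b) (e q : ℕ) (i : Fin 12) :
    0 < prodMass p (ka * (13 * e) + kb * q) (schottkyElt a b e q i) := by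
  have h := prodMass_mul_pos (prodMass_mul_pos (prodMass_pow_pos ha ((i + 1) * e))
    (prodMass_pow_pos hb q)) (prodMass_pow_pos ha ((12 - i) * e))
  have hk : ka * ((i + 1) * e) + kb * q + ka * ((12 - i) * e) = ka * (13 * e) + kb * q := by
    have hi := i.2
    have : ((i : ℕ) + 1) + (12 - i) = 13 := by omega
    calc _ = ka * ((((i : ℕ) + 1) + (12 - i)) * e) + kb * q := by ring
      _ = _ := by rw [this]
  rw [hk] at h
  exact h

/-- Exponential decay of the probability that the walk is not WPD, in the square root of the
number of steps. -/
lemma eventually_stepProb_not_isWPD_le {δ R : ℝ} (hδ : FourPoint X δ)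
    (hgeo : HasGeodesicPoints X) {o : X} (hp : ∑' g, p g = 1) (hR0 : 0 ≤ R)
    (hR : ∀ g, p g ≠ 0 → dist o (g • o) ≤ R) {ε A lam : ℝ} (hε : 0 < ε) (hA : 0 < A)
    (hlam0 : 0 < lam) (hlam1 : lam < 1) (h : HasExpDecay p o ε A lam)
    {C D : ℝ} {s : Fin 12 → G} (hs : IsSchottky o C D s) (hC : 0 ≤ C)
    (hD : 2 * C + 3 * δ + 1 ≤ D)
    {H : G} (hH : 2 * C + 3 * δ + 1 ≤ dist o (H • o))
    (hfin : (jointCoarseStab G (2 * (C + 2 * δ + 2 * δ) + 2 * δ + 1) o (H • o)).Finite)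
    {θ : ℝ} (hθ0 : 0 < θ) (hθ1 : θ < 1) {k : ℕ}
    (hθ : ∀ (m : ℕ) (u : G), stepProb p (k + m)
      {l | ¬ IsAlignedInsertion o C s H u (l.take k).prod (l.drop k).prod} ≤ ENNReal.ofReal θ) :
    ∃ B c : ℝ, 0 ≤ B ∧ 0 < c ∧ c < 1 ∧ ∀ᶠ m : ℕ in atTop, ∀ n, Nat.sqrt n = m →
      stepProb p n {l | ¬ IsWPD X l.prod} ≤ ENNReal.ofReal (B * c ^ m) := by
  have hδ0 := hδ.nonneg o
  -- So that $\lambda=e^{-4\varepsilon\kappa}$: with $d=\kappa m$ and $r=\kappa m/4$, the shortness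
  -- error is of order $e^{-3\varepsilon\kappa m}$ and the junction error, up to a polynomial
  -- factor, of order $e^{-\varepsilon\kappa m/8}=q^{2m}$. One factor $q^m$ absorbs the polynomial
  -- in $m$.
  set κ : ℝ := -Real.log lam / (4 * ε) with hκdef
  have hκ : 0 < κ := div_pos (neg_pos.2 (Real.log_neg hlam0 hlam1)) (by positivity)
  have hlam : lam = Real.exp (-(4 * ε * κ)) := by
    rw [hκdef, mul_div_cancel₀ _ (by positivity), neg_neg, Real.exp_log hlam0]
  set q : ℝ := Real.exp (-(ε * κ / 16)) with hq
  have hq0 : 0 < q := Real.exp_pos _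
  have hq1 : q < 1 := by rw [hq, Real.exp_lt_one_iff]; have := mul_pos hε hκ; linarith
  obtain ⟨B₁, hB₁, hcube⟩ := exists_cube_mul_pow_le hq0.le hq1
  set A' : ℝ := A * (3 / lam ^ k + 2) with hA'
  have hA'0 : 0 < A' := by positivity
  refine ⟨1 / θ ^ 2 + A' * B₁, max θ q, by positivity, lt_max_of_lt_left hθ0,
    max_lt hθ1 hq1, ?_⟩
  have hbig : ∀ᶠ m : ℕ in atTop, 2 * (C + 3 * δ + 1) / κ ≤ m :=
    tendsto_natCast_atTop_atTop.eventually (eventually_ge_atTop _)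
  filter_upwards [eventually_exists_sq_le_two_pow hκ hδ0 R, hbig, eventually_ge_atTop k,
    eventually_ge_atTop 2] with m hK hm₁ hkm hm2 n hnm
  obtain ⟨K, hK₁, hK₂⟩ := hK
  rw [div_le_iff₀ hκ] at hm₁
  have hn₁ : m * m ≤ n := by rw [← hnm]; exact Nat.sqrt_le n
  have hn₂ : n < (m + 1) ^ 2 := by
    rw [← hnm, sq]; exact Nat.lt_succ_sqrt n
  -- One block of $m$ steps is reserved for $u$ and at least one for $z$, which leaves $m-2$ trials.
  obtain ⟨L, rfl⟩ : ∃ L, m = L + 2 := ⟨m - 2, by omega⟩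
  set m := L + 2 with hm
  have hsq : m * m = m + (m * L + m) := by rw [hm]; ring
  have main := stepProb_not_isWPD_le hδ hgeo hp hR0 hR hε hA hlam0 hlam1 h (d := κ * m)
    (r := κ * m / 4) hs hC (by positivity) hD (by linarith) (by linarith) hH hfin (θ := θ) hkm
    (fun u => by have := hθ (m - k) u; rwa [Nat.add_sub_cancel' hkm] at this)
    (L := L) (z := n - m * m + m) (n := n) (K := K) (by omega) (by omega) (by omega) hK₂
  refine main.trans ?_
  have hm0 : (0 : ℝ) ≤ m := Nat.cast_nonneg m
  have e₁ : lam ^ (m - k) * Real.exp (ε * (κ * m)) ≤ 1 / lam ^ k * (q ^ m * q ^ m) := by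
    have : lam ^ (m - k) = lam ^ m / lam ^ k := by
      rw [eq_div_iff (pow_pos hlam0 k).ne', ← pow_add, Nat.sub_add_cancel hkm]
    rw [this]
    have h₁ : lam ^ m * Real.exp (ε * (κ * m)) ≤ q ^ m * q ^ m := by
      rw [hlam, hq, ← Real.exp_nat_mul, ← Real.exp_nat_mul, ← Real.exp_add, ← Real.exp_add,
        Real.exp_le_exp]
      have : 0 ≤ m * (ε * κ) := by positivity
      linarith
    calc lam ^ m / lam ^ k * Real.exp (ε * (κ * m))
        = 1 / lam ^ k * (lam ^ m * Real.exp (ε * (κ * m))) := by ring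
      _ ≤ _ := by gcongr
  have e₂ : Real.exp (-ε * (κ * m / 4 / 2)) = q ^ m * q ^ m := by
    rw [hq, ← Real.exp_nat_mul, ← Real.exp_add]; congr 1; ring
  have hn₃ : (n : ℝ) + 1 ≤ (m + 1) ^ 2 := by exact_mod_cast hn₂
  have hone : (1 : ℝ) ≤ (m + 1) ^ 2 := one_le_pow₀ (by linarith)
  have hqq : 0 ≤ q ^ m * q ^ m := by positivity
  have e₃ : 3 * (A * lam ^ (m - k) * Real.exp (ε * (κ * m))) +
      2 * ((n + 1) * (A * Real.exp (-ε * (κ * m / 4 / 2)))) ≤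
      (m + 1) ^ 2 * (A' * (q ^ m * q ^ m)) := by
    rw [e₂]
    calc _ ≤ 3 * (A * (1 / lam ^ k * (q ^ m * q ^ m))) * (m + 1) ^ 2 +
          2 * ((m + 1) ^ 2 * (A * (q ^ m * q ^ m))) := by
          refine add_le_add ?_ (by gcongr)
          rw [mul_assoc A]
          refine le_trans (mul_le_mul_of_nonneg_left (mul_le_mul_of_nonneg_left e₁ hA.le)
            (by norm_num)) (le_mul_of_one_le_right ?_ hone)
          positivity
      _ = _ := by rw [hA']; ring
  have hL : (L : ℝ) ≤ m + 1 := by rw [hm]; push_cast; linarith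
  have e₄ : L * ((m + 1 : ℝ) ^ 2 * (A' * (q ^ m * q ^ m))) ≤ A' * B₁ * (max θ q) ^ m := by
    calc L * ((m + 1 : ℝ) ^ 2 * (A' * (q ^ m * q ^ m)))
        ≤ (m + 1) * ((m + 1 : ℝ) ^ 2 * (A' * (q ^ m * q ^ m))) := by gcongr
      _ = A' * ((m + 1 : ℝ) ^ 3 * q ^ m) * q ^ m := by ring
      _ ≤ A' * B₁ * (max θ q) ^ m := by
        gcongr
        · exact hcube m
        · exact le_max_right _ _
  have e₅ : θ ^ L ≤ 1 / θ ^ 2 * (max θ q) ^ m := by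
    calc θ ^ L = 1 / θ ^ 2 * θ ^ m := by rw [hm, pow_add]; field_simp
      _ ≤ _ := by gcongr; exact le_max_left _ _
  rw [← ENNReal.ofReal_pow hθ0.le, ← ENNReal.ofReal_natCast L,
    ← ENNReal.ofReal_mul (Nat.cast_nonneg L), ← ENNReal.ofReal_add (by positivity)
      (by positivity)]
  refine ENNReal.ofReal_le_ofReal ?_
  rw [add_mul (1 / θ ^ 2)]
  exact add_le_add e₅ ((mul_le_mul_of_nonneg_left e₃ (Nat.cast_nonneg L)).trans e₄)

theorem exists_stepProb_not_isWPD_le (hX : IsGromovHyperbolic X) (hp : ∑' g, p g = 1) {o : X}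
    {R : ℝ} (hR0 : 0 ≤ R) (hR : ∀ g, p g ≠ 0 → dist o (g • o) ≤ R) {a b h : G}
    (ha : a ∈ Subsemigroup.closure {g | p g ≠ 0}) (hb : b ∈ Subsemigroup.closure {g | p g ≠ 0})
    (hab : AreIndependentLoxodromic X a b)
    (hh : h ∈ Subsemigroup.closure {g | p g ≠ 0}) (hwpd : IsWPD X h) :
    ∃ B c : ℝ, 0 < B ∧ 0 < c ∧ c < 1 ∧ ∀ n : ℕ,
      stepProb p n {l | ¬ IsWPD X l.prod} ≤ ENNReal.ofReal (B * c ^ Real.sqrt n) := by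
  obtain ⟨δ, hδ⟩ := hX.exists_fourPoint
  have hδ0 := hδ.nonneg o
  obtain ⟨e, C, hC, hS⟩ := exists_isSchottky hδ o hab
  obtain ⟨q, D, hD, hs⟩ := hS (40 * C + 40 * δ + 40)
  obtain ⟨ka, hka⟩ := exists_prodMass_pos ha
  obtain ⟨kb, hkb⟩ := exists_prodMass_pos hb
  obtain ⟨kh, hkh⟩ := exists_prodMass_pos hh
  have hsp := prodMass_schottkyElt_pos hka hkb e q
  obtain ⟨M, hfin, hM⟩ := hwpd.exists_pow hδ o
    (K := 2 * (C + 2 * δ + 2 * δ) + 2 * δ + 1) (by positivity) (2 * C + 3 * δ + 1)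
  obtain ⟨θ, hθ0, hθ1, hθ⟩ := hs.exists_stepProb_not_aligned_le hp (H := h ^ M) fun i j =>
    prodMass_mul_pos (prodMass_mul_pos (hsp i) (prodMass_pow_pos hkh M)) (hsp j)
  obtain ⟨N, hN, hdrift⟩ := exists_drift hδ hp hR hsp hs hC hD
  obtain ⟨ε, A, lam, hε, hA, hlam0, hlam1, hdec⟩ := exists_hasExpDecay hR0 hp hR hN hdrift
  obtain ⟨B₀, c, hB₀, hc0, hc1, hev⟩ := eventually_stepProb_not_isWPD_le hδ hX.hasGeodesicPoints hp
    hR0 hR hε hA hlam0 hlam1 hdec hs hC (by linarith) hM hfin hθ0 hθ1 hθ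
  obtain ⟨B, hB, hfinal⟩ := exists_le_rpow_sqrt (fun n => stepProb_le_one hp n _) hB₀ hc0 hc1 hev
  exact ⟨B, c, hB, hc0, hc1, hfinal⟩

end Conclusion

/-! ### Comparison with the law of the infinite sequence of steps. -/

lemma stepExp_eq_tsum {G : Type*} {p : G → ℝ≥0∞} (n : ℕ) (F : List G → ℝ≥0∞) :
    stepExp p n F = ∑' f : Fin n → G, (∏ i, p (f i)) * F (List.ofFn f) := by
  induction n generalizing F with
  | zero =>
    rw [tsum_eq_single default fun f hf => absurd (Subsingleton.elim f default) hf]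
    simp [stepExp]
  | succ n ih =>
    rw [← (Fin.consEquiv fun _ : Fin (n + 1) => G).tsum_eq, ENNReal.tsum_prod']
    simp only [stepExp, ih, ← ENNReal.tsum_mul_left]
    refine tsum_congr fun g => tsum_congr fun f => ?_
    simp [Fin.consEquiv, Fin.prod_univ_succ, List.ofFn_succ, mul_assoc]

lemma walk_eq_prod_ofFn {G : Type*} [Group G] (ω : ℕ → G) (n : ℕ) :
    walk ω n = (List.ofFn fun i : Fin n => ω i).prod := by
  induction n with
  | zero => simp [walk]
  | succ n ih => rw [walk, ih, List.ofFn_succ', List.concat_eq_append, List.prod_append]; simp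

section Law

variable {G : Type*} [MeasurableSpace G]

lemma IsCountableMeasure.countable_atoms {μ : Measure G} (h : IsCountableMeasure μ) :
    (atoms μ).Countable := by
  obtain ⟨S, hS, h0⟩ := h
  refine hS.mono fun g hg => ?_
  by_contra hgS
  exact hg (measure_mono_null (Set.singleton_subset_iff.2 hgS) h0)

lemma IsCountableMeasure.measure_compl_atoms {μ : Measure G}
    (h : IsCountableMeasure μ) : μ (atoms μ)ᶜ = 0 := by
  obtain ⟨S, hS, h0⟩ := h
  have h₁ : μ (⋃ g ∈ S \ atoms μ, {g}) = 0 :=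
    (measure_biUnion_null_iff (hS.mono Set.sdiff_subset)).2 fun g hg => not_not.1 hg.2
  rw [Set.biUnion_of_singleton] at h₁
  refine measure_mono_null (fun g hg => ?_) (measure_union_null h0 h₁)
  by_cases hgS : g ∈ S
  · exact Or.inr ⟨hgS, hg⟩
  · exact Or.inl hgS

variable [MeasurableSingletonClass G]

lemma IsCountableMeasure.tsum_singleton {μ : Measure G} [IsProbabilityMeasure μ]
    (h : IsCountableMeasure μ) : ∑' g, μ {g} = 1 := by
  have hc := h.countable_atoms
  have h₁ : μ (atoms μ) = 1 := by
    have := prob_add_prob_compl (μ := μ) hc.measurableSet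
    rwa [h.measure_compl_atoms, add_zero] at this
  rw [← h₁]
  conv_rhs => rw [← Set.biUnion_of_singleton (atoms μ)]
  rw [measure_biUnion hc (fun a _ b _ hab => Set.disjoint_singleton.2 hab)
    fun g _ => measurableSet_singleton g]
  exact (tsum_subtype_eq_of_support_subset (f := fun g => μ {g}) fun g hg => hg).symm

lemma stepLaw_cylinder (μ : Measure G) [IsProbabilityMeasure μ] {n : ℕ} (f : Fin n → G) :
    stepLaw μ {ω | ∀ i : Fin n, ω i = f i} = ∏ i, μ {f i} := by
  let t : ℕ → Set G := fun i => if h : i < n then {f ⟨i, h⟩} else Set.univ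
  have e : {ω : ℕ → G | ∀ i : Fin n, ω i = f i} = Set.pi (Finset.range n) t := by
    ext ω
    simp only [Set.mem_pi, Finset.coe_range, Set.mem_Iio]
    constructor
    · intro h i hi
      simp only [t, dif_pos hi, Set.mem_singleton_iff]
      exact h ⟨i, hi⟩
    · intro h i
      have := h i i.2
      simpa only [t, dif_pos i.2, Set.mem_singleton_iff] using this
  rw [e, stepLaw, Measure.infinitePi_pi, Finset.prod_range]
  · refine Finset.prod_congr rfl fun i _ => ?_
    simp only [t, dif_pos i.2]
  · intro i hi
    simp only [t, dif_pos (Finset.mem_range.1 hi)]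
    exact measurableSet_singleton _

/-- Outside a null set the first $n$ steps are atoms, and the event is covered by countably many
cylinders. Countable subadditivity gives the inequality without any measurability of `A`. -/
lemma stepLaw_le_stepProb {μ : Measure G} [IsProbabilityMeasure μ]
    (h : IsCountableMeasure μ) (n : ℕ) (A : Set (List G)) :
    stepLaw μ {ω | List.ofFn (fun i : Fin n => ω i) ∈ A} ≤ stepProb (fun g => μ {g}) n A := by
  classical
  have hc : Countable (atoms μ) := h.countable_atoms.to_subtype
  have hnull : stepLaw μ (⋃ i : Fin n, {ω | ω i ∈ (atoms μ)ᶜ}) = 0 := by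
    refine measure_iUnion_null fun i => ?_
    exact (measurePreserving_eval_infinitePi (fun _ : ℕ => μ) i).quasiMeasurePreserving.preimage_null
      h.measure_compl_atoms
  let cyl : (Fin n → atoms μ) → Set (ℕ → G) := fun f =>
    {ω | (∀ i : Fin n, ω i = f i) ∧ List.ofFn (fun i => (f i : G)) ∈ A}
  have hsub : {ω | List.ofFn (fun i : Fin n => ω i) ∈ A} ⊆
      (⋃ i : Fin n, {ω : ℕ → G | ω i ∈ (atoms μ)ᶜ}) ∪ ⋃ f, cyl f := by
    intro ω hω
    by_cases hat : ∀ i : Fin n, ω i ∈ atoms μ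
    · exact Or.inr (Set.mem_iUnion.2 ⟨fun i => ⟨ω i, hat i⟩, fun i => rfl, hω⟩)
    · push Not at hat
      obtain ⟨i, hi⟩ := hat
      exact Or.inl (Set.mem_iUnion.2 ⟨i, hi⟩)
  refine (measure_mono hsub).trans ((measure_union_le _ _).trans ?_)
  rw [hnull, zero_add]
  refine (measure_iUnion_le _).trans ?_
  rw [stepProb, stepExp_eq_tsum]
  have hinj : Function.Injective fun (f : Fin n → atoms μ) (i : Fin n) => (f i : G) :=
    fun f g hfg => funext fun i => Subtype.ext (congrFun hfg i)
  refine le_trans (ENNReal.tsum_le_tsum fun f => ?_)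
    (ENNReal.tsum_comp_le_tsum_of_injective hinj _)
  by_cases hf : List.ofFn (fun i => (f i : G)) ∈ A
  · rw [Set.indicator_of_mem hf, Pi.one_apply, mul_one, ← stepLaw_cylinder]
    exact measure_mono fun ω hω => hω.1
  · have : cyl f = ∅ := Set.eq_empty_of_forall_notMem fun ω hω => hf hω.2
    rw [this, measure_empty]
    exact bot_le

end Law

end WPD

end

theorem mainTheorem8 {G : Type*} [Group G] [MeasurableSpace G] [MeasurableSingletonClass G]
    {X : Type*} [MetricSpace X] [MulAction G X] [IsIsometricSMul G X]
    (hX : WPD.IsGromovHyperbolic X)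
    (μ : MeasureTheory.Measure G) [MeasureTheory.IsProbabilityMeasure μ]
    (hcount : WPD.IsCountableMeasure μ)
    (hne : WPD.IsNonElementary X μ)
    (hbdd : WPD.IsBoundedMeasure X μ)
    (hwpd : WPD.IsWPDMeasure X μ) :
    ∃ B c : ℝ, 0 < B ∧ 0 < c ∧ c < 1 ∧ ∀ n : ℕ,
      1 - B * c ^ Real.sqrt (n : ℝ) ≤
        (WPD.stepLaw μ).real {ω : ℕ → G | WPD.IsWPD X (WPD.walk ω n)} := by
  obtain ⟨a, ha, b, hb, hab⟩ := hne
  obtain ⟨h, hh, hhw⟩ := hwpd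
  obtain ⟨o, ho⟩ := hbdd
  obtain ⟨r, hr⟩ := (Metric.isBounded_iff_subset_closedBall o).1 ho
  have hR : ∀ g : G, μ {g} ≠ 0 → dist o (g • o) ≤ max r 0 := fun g hg => by
    rw [dist_comm]
    exact (Metric.mem_closedBall.1 (hr ⟨g, hg, rfl⟩)).trans (le_max_left r 0)
  obtain ⟨B, c, hB, hc0, hc1, hbound⟩ := WPD.exists_stepProb_not_isWPD_le (p := fun g => μ {g}) hX
    hcount.tsum_singleton (le_max_right r 0) hR ha hb hab hh hhw
  refine ⟨B, c, hB, hc0, hc1, fun n => ?_⟩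
  have : IsProbabilityMeasure (WPD.stepLaw μ) := by
    rw [WPD.stepLaw]; infer_instance
  set T := {ω : ℕ → G | WPD.IsWPD X (WPD.walk ω n)} with hT
  have hle : WPD.stepLaw μ Tᶜ ≤ ENNReal.ofReal (B * c ^ Real.sqrt n) := by
    refine le_trans (le_of_eq ?_) ((WPD.stepLaw_le_stepProb hcount n
      {l | ¬ WPD.IsWPD X l.prod}).trans (hbound n))
    congr 1
    ext ω
    change ¬ WPD.IsWPD X (WPD.walk ω n) ↔ ¬ WPD.IsWPD X _
    rw [WPD.walk_eq_prod_ofFn]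
  have hpos : 0 ≤ B * c ^ Real.sqrt n := by positivity
  have h₁ : (WPD.stepLaw μ).real Tᶜ ≤ B * c ^ Real.sqrt n :=
    ENNReal.toReal_le_of_le_ofReal hpos hle
  -- The event need not be measurable, so the lower bound comes from subadditivity applied to it and
  -- its complement.
  have h₂ := measureReal_union_le (μ := WPD.stepLaw μ) T Tᶜ
  rw [Set.union_compl_self, probReal_univ] at h₂
  linarith
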